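/- Let $\mathcal M=\mathrm{SL}_2(\mathbb Z)\backslash\mathbb H$ be the modular surface, with $\Gamma=\mathrm{SL}_2(\mathbb Z)$ acting on the upper half-plane $\mathbb H$ by Möbius transformations. For $n\in\mathbb N=\{1,2,\dots\}$, $x\in\mathbb R/\mathbb Z$ and $y>0$ let $$\delta_{n,x,y}=\frac1n\sum_{j=0}^{n-1}\delta_{\Gamma(x+\frac jn+iy)}$$ be the normalized counting measure (with multiplicity) on the points $\Gamma(x+\frac jn+iy)$, $0\le j\le n-1$. For $Y>0$ let $\mu_Y$ be the uniform probability measure on the closed horocycle $\{\Gamma(x+iY):x\in\mathbb R/\mathbb Z\}$, that is, the image of the Lebesgue probability measure on $\mathbb R/\mathbb Z$ under $x\mapsto\Gamma(x+iY)$. For $m\in\mathbb N$ and $Y>0$ put $$\nu_{m,Y}=\frac1m\sum_{d\mid m}\varphi\!\left(\tfrac md\right)\mu_{d^2Y},\qquad \mathbb P_m=\{m\ell:\ \ell\text{ prime},\ \ell\nmid m\},$$ where $\varphi$ is Euler's totient function. A finite Borel measure $\nu$ on $\mathcal M$ is a limiting measure of a sequence $(\delta_n)_{n\in\mathbb P_m}$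 of measures on $\mathcal M$ if there are $n_1<n_2<\cdots$ in $\mathbb P_m$ with $\delta_{n_k}(\Psi)\to\nu(\Psi)$ as $k\to\infty$ for every continuous compactly supported $\Psi:\mathcal M\to\mathbb R$. **Theorem 1.7.** Let $m\in\mathbb N$ and $Y>0$ satisfy $m^2Y>1$. For every sequence of positive numbers $(c_n)_{n\in\mathbb P_m}$ there is a sequence $(y_n)_{n\in\mathbb P_m}$ with $0<y_n<c_n$ for all $n\in\mathbb P_m$ such that, for Lebesgue-almost every $x\in\mathbb R/\mathbb Z$, the measure $\nu_{m,Y}$ is a limiting measure of $(\delta_{n,x,y_n})_{n\in\mathbb P_m}$. -/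

import Mathlib

open MeasureTheory Filter Topology UpperHalfPlane
open scoped MatrixGroups CompactlySupported

noncomputable section

/-- The modular surface `Γ \ ℍ` for `Γ = SL(2, ℤ)` acting by Moebius transformations. -/
def ModularSurface : Type := MulAction.orbitRel.Quotient SL(2, ℤ) ℍ

namespace ModularSurface

/-- The class `Γ z` of a point `z` of the upper half-plane. -/
def mk (z : ℍ) : ModularSurface := Quotient.mk (MulAction.orbitRel SL(2, ℤ) ℍ) z

/-- The quotient topology. -/
instance : TopologicalSpace ModularSurface :=
  inferInstanceAs (TopologicalSpace (Quotient (MulAction.orbitRel SL(2, ℤ) ℍ)))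

/-- The Borel `σ`-algebra. -/
instance : MeasurableSpace ModularSurface := borel ModularSurface

instance : BorelSpace ModularSurface := ⟨rfl⟩

theorem continuous_mk : Continuous mk := continuous_quotient_mk'

/-- The point `Γ(x + iy)` for a real number `x` and `y > 0`
(for `y ≤ 0` this is a constant junk value, which is never used). -/
def realPoint (y x : ℝ) : ModularSurface :=
  mk (UpperHalfPlane.ofComplex (⟨x, y⟩ : ℂ))

theorem realPoint_periodic (y : ℝ) : Function.Periodic (realPoint y) 1 := by
  intro x
  by_cases hy : 0 < y
  · refine Quotient.sound (MulAction.orbitRel_apply.mpr ⟨ModularGroup.T, ?_⟩)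
    ext1
    have h1 : 0 < (⟨x, y⟩ : ℂ).im := hy
    have h2 : 0 < (⟨x + 1, y⟩ : ℂ).im := hy
    simp only [UpperHalfPlane.modular_T_smul]
    rw [UpperHalfPlane.coe_vadd, UpperHalfPlane.ofComplex_apply_of_im_pos h1,
      UpperHalfPlane.ofComplex_apply_of_im_pos h2]
    apply Complex.ext <;> simp [add_comm]
  · have h1 : (⟨x, y⟩ : ℂ).im ≤ 0 := not_lt.mp hy
    have h2 : (⟨x + 1, y⟩ : ℂ).im ≤ 0 := not_lt.mp hy
    simp only [realPoint, UpperHalfPlane.ofComplex_apply_of_im_nonpos h1,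
      UpperHalfPlane.ofComplex_apply_of_im_nonpos h2]

theorem continuous_realPoint {y : ℝ} (hy : 0 < y) : Continuous (realPoint y) := by
  have h : realPoint y = fun x : ℝ => mk (⟨(⟨x, y⟩ : ℂ), hy⟩ : ℍ) := by
    funext x
    exact congrArg mk (UpperHalfPlane.ofComplex_apply_of_im_pos (z := (⟨x, y⟩ : ℂ)) hy)
  rw [h]
  refine continuous_mk.comp ?_
  rw [UpperHalfPlane.isEmbedding_coe.continuous_iff]
  have : (fun x : ℝ => (⟨x, y⟩ : ℂ)) = fun x : ℝ => (x : ℂ) + y * Complex.I := by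
    funext x
    apply Complex.ext <;> simp
  change Continuous (fun x : ℝ => (⟨x, y⟩ : ℂ))
  rw [this]
  fun_prop

/-- The point `Γ(x + iy)` of the closed horocycle of height `y > 0`, for `x ∈ ℝ/ℤ`. -/
def point (y : ℝ) : UnitAddCircle → ModularSurface := (realPoint_periodic y).lift

theorem continuous_point {y : ℝ} (hy : 0 < y) : Continuous (point y) :=
  continuous_coinduced_dom.mpr (continuous_realPoint hy)

/-- The uniform probability measure `μ_Y` on the closed horocycle `{Γ(x + iY) : x ∈ ℝ/ℤ}`:
the image of the probability Haar measure of `ℝ/ℤ` under `x ↦ Γ(x + iY)`. -/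
def horocycleMeasure (Y : ℝ) : Measure ModularSurface :=
  (volume : Measure UnitAddCircle).map (point Y)

/-- The measure `ν_{m,Y} = (1/m) ∑_{d ∣ m} φ(m/d) μ_{d²Y}`. -/
def nu (m : ℕ) (Y : ℝ) : Measure ModularSurface :=
  (m : ENNReal)⁻¹ • ∑ d ∈ m.divisors, (Nat.totient (m / d) : ENNReal) • horocycleMeasure (d ^ 2 * Y)

/-- The normalized counting measure `δ_{n,x,y} = (1/n) ∑_{0 ≤ j < n} δ_{Γ(x + j/n + iy)}`
(points are counted with multiplicity). -/
def delta (n : ℕ) (x : UnitAddCircle) (y : ℝ) : Measure ModularSurface :=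
  (n : ENNReal)⁻¹ •
    ∑ j ∈ Finset.range n, Measure.dirac (point y (x + (((j : ℝ) / (n : ℝ) : ℝ) : UnitAddCircle)))

/-- The set of limiting measures of a sequence of measures indexed by a set `P` of natural numbers:
the finite measures to which the sequence converges, along some infinite increasing sequence of
indices in `P`, when tested against compactly supported continuous functions. -/
def limitMeasures (P : Set ℕ) (δ : ℕ → Measure ModularSurface) : Set (Measure ModularSurface) :=
  {ν | IsFiniteMeasure ν ∧ ∃ k : ℕ → ℕ, StrictMono k ∧ (∀ i, k i ∈ P) ∧
    ∀ Ψ : C_c(ModularSurface, ℝ),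
      Tendsto (fun i => ∫ z, Ψ z ∂(δ (k i))) atTop (𝓝 (∫ z, Ψ z ∂ν))}

end ModularSurface

/-- `P_m = {mℓ : ℓ prime, ℓ ∤ m}`. -/
def primeMultiples (m : ℕ) : Set ℕ := {n | ∃ l : ℕ, l.Prime ∧ ¬ l ∣ m ∧ n = m * l}

end

/-!
Let `n = m ℓ` with `ℓ` a prime not dividing `m`. The proof rests on a set of `x`, `approxSet`, on
which `δ_{n,x,y}` is close to `ν_{m,Y}`, and on the fact that its proportion in any compact set is
at least of order `1 / n`, as soon as `y` is small enough.

*Closeness.* Let `x` be very near a fraction `m a / (n q)`, where `q` is prime to `n` and to `m a`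
and `n² q² y Y` is nearly `1`. Then `x + j / n` is near `(m a + j q) / (n q)`. Unless `ℓ` divides
the numerator, which happens for one `j` out of `ℓ`, the reduced denominator is `n q / d` with
`d = gcd(j, m)`, and an element of `SL(2, ℤ)` carries `x + j / n + iy` to a point of height nearly
`d² Y`, whose real part is minus the inverse of the numerator divided by the denominator
(`realPoint_eq_of_det`). For `j` in a fixed residue class modulo `m`, these real parts are, modulo
one, `ℓ - 1` of the `ℓ` points of a coset of `ℓ⁻¹ ℤ / ℤ`, because inversion permutes the nonzero
residues modulo `ℓ` (`exists_neg_inverses`). So they equidistribute as `ℓ` grows, and averaging over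
the residue classes modulo `m`, of which `φ(m / d)` have greatest common divisor `d` with `m`, gives
`ν_{m,Y}` (`eventually_abs_integral_delta_sub_le`).

*Proportion.* The pairs `(q, a)` are counted by a sieve, which succeeds since `∑_{r ≥ 2} 1 / r²` is
less than one (`eventually_le_card_fractionPairs`). The intervals around the corresponding
fractions are disjoint, and they cover at least a proportion `b / (k² n)` of every compact subset of
`[0, 1]` when `y` is small; here `1 / k` measures the accuracy of the approximation
(`exists_eventually_le_volume_inter_approxSet`).

*Conclusion.* The sum of the reciprocals of the primes diverges. Choosing the `y n` one after the
other, each small in terms of the set left uncovered by its predecessors, therefore makes the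
uncovered set null for every accuracy `1 / k` (`exists_seq_ae_forall_exists_mem`). For almost every
`x` there is then, for every large `k`, an index `n ≥ k` at which `δ_{n,x,y n}` is close to
`ν_{m,Y}`.
-/

/-! ### Points of the modular surface and Riemann sums -/

namespace ModularSurface

/-- The action of `!![A, B; C, -K]` on a point `K / C + θ + iy` above the rational number `K / C`,
in coordinates. -/
theorem realPoint_eq_of_det {A B C K : ℤ} (hdet : -(A * K) - B * C = 1) (hC : 0 < C)
    {y : ℝ} (hy : 0 < y) (θ : ℝ) :
    realPoint y (K / C + θ) =
      realPoint (y / (C ^ 2 * (θ ^ 2 + y ^ 2))) (A / C - θ / (C ^ 2 * (θ ^ 2 + y ^ 2))) := by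
  have hC' : (0 : ℝ) < C := by exact_mod_cast hC
  have hN : 0 < θ ^ 2 + y ^ 2 := by positivity
  have hh : 0 < y / (C ^ 2 * (θ ^ 2 + y ^ 2)) := by positivity
  have hdet' : (B : ℝ) = (-1 - A * K) / C := by
    rw [eq_div_iff hC'.ne']
    have : (B * C : ℤ) = -1 - A * K := by linarith
    exact_mod_cast this
  let γ : SL(2, ℤ) := ⟨!![A, B; C, -K], by rw [Matrix.det_fin_two_of]; linarith⟩
  unfold realPoint
  refine (Quotient.sound (MulAction.orbitRel_apply.mpr ⟨γ, ?_⟩)).symm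
  have h1 : 0 < (⟨K / C + θ, y⟩ : ℂ).im := hy
  have h2 : 0 < (⟨A / C - θ / (C ^ 2 * (θ ^ 2 + y ^ 2)), y / (C ^ 2 * (θ ^ 2 + y ^ 2))⟩ : ℂ).im := hh
  ext1
  change ((γ • _ : ℍ) : ℂ) = _
  rw [UpperHalfPlane.coe_specialLinearGroup_apply, ofComplex_apply_of_im_pos h1,
    ofComplex_apply_of_im_pos h2]
  have hden : (C : ℂ) * (⟨K / C + θ, y⟩ : ℂ) - K ≠ 0 := by
    intro h
    have := congrArg Complex.im h
    simp at this
    rcases this with h | h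
    · exact hC.ne' h
    · exact hy.ne' h
  simp only [γ, algebraMap_int_eq, eq_intCast, Matrix.cons_val', Matrix.cons_val_zero,
    Matrix.cons_val_one, Matrix.cons_val_fin_one, Matrix.of_apply, Complex.ofReal_intCast,
    Complex.ofReal_neg, Int.cast_neg, ← sub_eq_add_neg]
  rw [div_eq_iff hden]
  apply Complex.ext
  · simp [hdet']
    field_simp
    ring
  · simp
    field_simp
    ring

/-- Uniform continuity in the horizontal direction: the horizontal coordinate may be reduced to
the compact interval `[0, 1]`. -/
theorem exists_uniform_radius {Ψ : ModularSurface → ℝ} (hΨ : Continuous Ψ) {h₀ ε : ℝ}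
    (hh₀ : 0 < h₀) (hε : 0 < ε) :
    ∃ ρ > 0, ∀ u h : ℝ, |u| < ρ → |h - h₀| < ρ → ∀ X : ℝ,
      |Ψ (realPoint h (X + u)) - Ψ (realPoint h₀ X)| < ε := by
  have key : ∀ᶠ p : ℝ × ℝ in 𝓝 (0, h₀), ∀ X ∈ Set.Icc (0 : ℝ) 1,
      |Ψ (realPoint p.2 (X + p.1)) - Ψ (realPoint h₀ X)| < ε := by
    refine isCompact_Icc.eventually_forall_of_forall_eventually fun X _ => ?_
    have hc : ContinuousAt (fun z : (ℝ × ℝ) × ℝ =>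
        |Ψ (realPoint z.1.2 (z.2 + z.1.1)) - Ψ (realPoint h₀ z.2)|) ((0, h₀), X) := by
      have h1 : ContinuousAt (fun z : (ℝ × ℝ) × ℝ => realPoint z.1.2 (z.2 + z.1.1))
          ((0, h₀), X) := by
        refine continuous_mk.continuousAt.comp ?_
        refine ContinuousAt.comp (f := fun z : (ℝ × ℝ) × ℝ => (⟨z.2 + z.1.1, z.1.2⟩ : ℂ)) ?_ ?_
        · exact (contMDiffAt_ofComplex (n := 0) (by simpa using hh₀)).continuousAt
        · have : (fun z : (ℝ × ℝ) × ℝ => (⟨z.2 + z.1.1, z.1.2⟩ : ℂ)) =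
              fun z => ((z.2 + z.1.1 : ℝ) : ℂ) + (z.1.2 : ℝ) * Complex.I := by
            funext z
            apply Complex.ext <;> simp
          rw [this]
          fun_prop
      have h2 : ContinuousAt (fun z : (ℝ × ℝ) × ℝ => realPoint h₀ z.2) ((0, h₀), X) :=
        ((continuous_realPoint hh₀).comp continuous_snd).continuousAt
      exact ((hΨ.continuousAt.comp h1).sub (hΨ.continuousAt.comp h2)).abs
    refine hc.eventually_lt_const ?_
    simpa using hε
  obtain ⟨ρ, hρ, hball⟩ := Metric.eventually_nhds_iff.mp key
  refine ⟨ρ, hρ, fun u h hu hh X => ?_⟩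
  have := @hball (u, h) (by
    rw [Prod.dist_eq, max_lt_iff]
    exact ⟨by simpa [Real.dist_eq] using hu, by simpa [Real.dist_eq] using hh⟩)
    (Int.fract X) ⟨Int.fract_nonneg X, (Int.fract_lt_one X).le⟩
  have e1 : realPoint h (Int.fract X + u) = realPoint h (X + u) := by
    have := (realPoint_periodic h).sub_int_mul_eq ⌊X⌋ (x := X + u)
    rw [← this]; congr 1; rw [Int.fract]; ring
  have e2 : realPoint h₀ (Int.fract X) = realPoint h₀ X := by
    have := (realPoint_periodic h₀).sub_int_mul_eq ⌊X⌋ (x := X)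
    rw [← this]; congr 1; rw [Int.fract]; ring
  simpa only [e1, e2] using this

end ModularSurface

/-- Riemann sums with equally spaced nodes, uniformly in the position of the first node. -/
theorem abs_sum_sub_integral_le {Φ : ℝ → ℝ} (hc : Continuous Φ) (hp : Function.Periodic Φ 1)
    {ε : ℝ} {N : ℕ} (hN : 0 < N)
    (hΦ : ∀ X u : ℝ, |u| ≤ 1 / N → |Φ (X + u) - Φ X| ≤ ε) (s : ℝ) :
    |∑ v ∈ Finset.range N, Φ (s + v / N) - N * ∫ t in (0 : ℝ)..1, Φ t| ≤ N * ε := by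
  have hN' : (0 : ℝ) < N := by exact_mod_cast hN
  have hI : ∫ t in (0 : ℝ)..1, Φ t =
      ∑ v ∈ Finset.range N, ∫ t in (s + v / N)..(s + (v + 1 : ℕ) / N), Φ t := by
    rw [intervalIntegral.sum_integral_adjacent_intervals
      (a := fun v : ℕ => s + v / N) (fun k _ => hc.intervalIntegrable _ _)]
    have := hp.intervalIntegral_add_eq 0 s
    simp only [zero_add] at this
    rw [this]
    simp [hN'.ne']
  rw [hI, Finset.mul_sum, ← Finset.sum_sub_distrib]
  refine (Finset.abs_sum_le_sum_abs _ _).trans ?_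
  have : ∀ v ∈ Finset.range N, |Φ (s + v / N) -
      N * ∫ t in (s + v / N)..(s + (v + 1 : ℕ) / N), Φ t| ≤ ε := by
    intro v _
    have hlen : (s + (v + 1 : ℕ) / N) - (s + (v : ℝ) / N) = 1 / N := by
      push_cast; field_simp; ring
    have e : Φ (s + v / N) - N * ∫ t in (s + v / N)..(s + (v + 1 : ℕ) / N), Φ t =
        - (N * ∫ t in (s + v / N)..(s + (v + 1 : ℕ) / N), (Φ t - Φ (s + v / N))) := by
      rw [intervalIntegral.integral_sub (hc.intervalIntegrable _ _) (by simp),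
        intervalIntegral.integral_const, hlen, smul_eq_mul]
      field_simp
      ring
    rw [e, abs_neg, abs_mul, abs_of_pos hN']
    have hle : s + (v : ℝ) / N ≤ s + (v + 1 : ℕ) / N := by
      have : (0 : ℝ) < 1 / N := by positivity
      linarith
    have := intervalIntegral.norm_integral_le_of_norm_le_const (C := ε)
      (f := fun t => Φ t - Φ (s + v / N)) (a := s + v / N) (b := s + (v + 1 : ℕ) / N) (by
        intro t ht
        rw [Set.uIoc_of_le hle] at ht
        have h := hΦ (s + v / N) (t - (s + v / N)) (by
          rw [abs_of_pos (by linarith [ht.1])]; linarith [ht.2])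
        rw [add_sub_cancel] at h
        exact h)
    rw [hlen, abs_of_pos (by positivity : (0 : ℝ) < 1 / N), Real.norm_eq_abs] at this
    calc (N : ℝ) * _ ≤ N * (ε * (1 / N)) := by gcongr
      _ = ε := by field_simp
  refine (Finset.sum_le_sum this).trans ?_
  simp

/-! ### Translates in one residue class -/

/-- Two sums of `N` bounded terms are close if all but one of the terms can be matched. -/
theorem abs_sum_sub_sum_le_of_injOn {N : ℕ} {S : Finset ℕ} (hS : S ⊆ Finset.range N)
    (hcard : N ≤ S.card + 1) {r : ℕ → ℕ} (hr : ∀ i ∈ S, r i < N) (hinj : Set.InjOn r S)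
    {f g : ℕ → ℝ} {M ε : ℝ} (hf : ∀ i, |f i| ≤ M) (hg : ∀ i, |g i| ≤ M) (hε : 0 ≤ ε)
    (hfg : ∀ i ∈ S, |f i - g (r i)| ≤ ε) :
    |∑ i ∈ Finset.range N, f i - ∑ i ∈ Finset.range N, g i| ≤ N * ε + 2 * M := by
  have hM : 0 ≤ M := (abs_nonneg _).trans (hf 0)
  have hT : S.image r ⊆ Finset.range N := by
    intro x hx
    obtain ⟨i, hi, rfl⟩ := Finset.mem_image.mp hx
    exact Finset.mem_range.mpr (hr i hi)
  have hTcard : (S.image r).card = S.card := Finset.card_image_of_injOn hinj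
  have hSN : S.card ≤ N := by simpa using Finset.card_le_card hS
  have rest : ∀ (T : Finset ℕ) (φ : ℕ → ℝ), T ⊆ Finset.range N → T.card = S.card →
      (∀ i, |φ i| ≤ M) → |∑ i ∈ Finset.range N \ T, φ i| ≤ M := by
    intro T φ hT hc hφ
    refine (Finset.abs_sum_le_sum_abs _ _).trans ((Finset.sum_le_card_nsmul _ _ M
      fun i _ => hφ i).trans ?_)
    have : (Finset.range N \ T).card ≤ 1 := by
      rw [Finset.card_sdiff_of_subset hT, Finset.card_range]; omega
    rw [nsmul_eq_mul]
    have h1 : ((Finset.range N \ T).card : ℝ) ≤ 1 := by exact_mod_cast this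
    nlinarith
  have hmain : |∑ i ∈ S, f i - ∑ i ∈ S.image r, g i| ≤ N * ε := by
    rw [Finset.sum_image hinj, ← Finset.sum_sub_distrib]
    refine (Finset.abs_sum_le_sum_abs _ _).trans ((Finset.sum_le_card_nsmul _ _ ε hfg).trans ?_)
    rw [nsmul_eq_mul]
    gcongr
  rw [← Finset.sum_sdiff hS, ← Finset.sum_sdiff hT (f := g)]
  have h1 := abs_le.mp (rest S f hS rfl hf)
  have h2 := abs_le.mp (rest _ g hT hTcard hg)
  have h3 := abs_le.mp hmain
  rw [abs_le]
  constructor <;> linarith [h1.1, h1.2, h2.1, h2.2, h3.1, h3.2]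

/-- Among the numerators `k₀ + i D`, those prime to `ℓ` have negated inverses modulo `Dℓ` which are
congruent modulo `D` and pairwise incongruent modulo `ℓ`. This is where the primality of `ℓ`
is used: only one numerator is lost. -/
theorem exists_neg_inverses {ℓ : ℕ} (hℓ : ℓ.Prime) {D k₀ : ℤ} (hℓD : ¬ (ℓ : ℤ) ∣ D)
    (hk : IsCoprime k₀ D) :
    ∃ (S : Finset ℕ) (A B : ℕ → ℤ) (A₀ : ℤ) (r : ℕ → ℕ), S ⊆ Finset.range ℓ ∧ ℓ ≤ S.card + 1 ∧
      Set.InjOn r S ∧ ∀ i ∈ S, r i < ℓ ∧ -(A i * (k₀ + i * D)) - B i * (D * ℓ) = 1 ∧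
        ∃ t : ℤ, A i = A₀ + D * (r i + ℓ * t) := by
  have hpr : Prime (ℓ : ℤ) := Nat.prime_iff_prime_int.mp hℓ
  have hℓ0 : (ℓ : ℤ) ≠ 0 := by exact_mod_cast hℓ.ne_zero
  have hℓpos : (0 : ℤ) < ℓ := by exact_mod_cast hℓ.pos
  have hD0 : D ≠ 0 := by rintro rfl; simp at hℓD
  have uniq : ∀ i j : ℕ, i < ℓ → j < ℓ → (ℓ : ℤ) ∣ (i - j) → i = j := by
    intro i j hi hj h
    have h1 : |(i : ℤ) - j| < ℓ := by rw [abs_lt]; constructor <;> omega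
    have := Int.eq_zero_of_abs_lt_dvd h h1
    omega
  let S : Finset ℕ := {i ∈ Finset.range ℓ | ¬ (ℓ : ℤ) ∣ k₀ + i * D}
  have hSs : S ⊆ Finset.range ℓ := Finset.filter_subset _ _
  have hcard : ℓ ≤ S.card + 1 := by
    have h1 : ({i ∈ Finset.range ℓ | (ℓ : ℤ) ∣ k₀ + i * D} : Finset ℕ).card ≤ 1 := by
      rw [Finset.card_le_one]
      intro i hi j hj
      simp only [Finset.mem_filter, Finset.mem_range] at hi hj
      refine uniq i j hi.1 hj.1 ?_
      have := dvd_sub hi.2 hj.2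
      rw [show k₀ + (i : ℤ) * D - (k₀ + j * D) = (i - j) * D by ring] at this
      exact (hpr.dvd_or_dvd this).resolve_right hℓD
    have h2 := Finset.card_filter_add_card_filter_not (s := Finset.range ℓ)
      (fun i : ℕ => (ℓ : ℤ) ∣ k₀ + i * D)
    rw [Finset.card_range] at h2
    change _ + S.card = _ at h2
    omega
  have hcopD : ∀ i : ℕ, IsCoprime (k₀ + i * D) D := fun i => by
    simpa using hk.add_mul_right_left (i : ℤ)
  have hAB : ∀ i : ℕ, ∃ A B : ℤ, i ∈ S → -(A * (k₀ + i * D)) - B * (D * ℓ) = 1 := by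
    intro i
    by_cases hi : i ∈ S
    · have h1 : IsCoprime (k₀ + i * D) (ℓ : ℤ) :=
        ((Prime.coprime_iff_not_dvd hpr).mpr (Finset.mem_filter.mp hi).2).symm
      obtain ⟨u, v, huv⟩ := (hcopD i).mul_right h1
      exact ⟨-u, -v, fun _ => by linarith⟩
    · exact ⟨0, 0, fun h => absurd h hi⟩
  choose A B hAB using hAB
  have hne : S.Nonempty := by
    rw [← Finset.card_pos]
    have := hℓ.two_le
    omega
  obtain ⟨i₀, hi₀⟩ := hne
  have hv : ∀ i : ℕ, ∃ v : ℤ, i ∈ S → A i = A i₀ + D * v := by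
    intro i
    by_cases hi : i ∈ S
    -- both `A i` and `A i₀` invert the same residue class modulo `D`, up to sign
    · have h1 : D ∣ (A i - A i₀) * (k₀ + i * D) := by
        refine ⟨(B i₀ - B i) * ℓ - A i₀ * (i - i₀), ?_⟩
        linear_combination -(hAB i hi) + (hAB i₀ hi₀)
      obtain ⟨v, hv⟩ := (hcopD i).symm.dvd_of_dvd_mul_right h1
      exact ⟨v, fun _ => by linarith⟩
    · exact ⟨0, fun h => absurd h hi⟩
  choose v hv using hv
  refine ⟨S, A, B, A i₀, fun i => (v i % ℓ).toNat, hSs, hcard, ?_, ?_⟩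
  · intro i hi j hj hij
    have h0 : v i % ℓ = v j % ℓ := by
      have h1 := Int.emod_nonneg (v i) hℓ0
      have h2 := Int.emod_nonneg (v j) hℓ0
      have : (v i % ℓ).toNat = (v j % ℓ).toNat := hij
      omega
    obtain ⟨w, hw⟩ := Int.ModEq.dvd (show v j ≡ v i [ZMOD ℓ] from h0.symm)
    refine uniq i j (Finset.mem_range.mp (hSs hi)) (Finset.mem_range.mp (hSs hj)) ?_
    have h1 : (ℓ : ℤ) ∣ (i - j) * (D * A i) := by
      refine ⟨-(D * w) * (k₀ + j * D) - (B i - B j) * D, ?_⟩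
      linear_combination -(hAB i hi) + (hAB j hj) - (k₀ + j * D) * (hv i hi - hv j hj)
        - D * (k₀ + j * D) * hw
    refine (hpr.dvd_or_dvd h1).resolve_right fun h2 => ?_
    rcases hpr.dvd_or_dvd h2 with h2 | h2
    · exact hℓD h2
    · obtain ⟨c, hc⟩ := h2
      have : (ℓ : ℤ) ∣ 1 := ⟨-(c * (k₀ + i * D)) - B i * D, by rw [← hAB i hi, hc]; ring⟩
      exact hpr.not_dvd_one this
  · intro i hi
    have h1 := Int.emod_nonneg (v i) hℓ0
    have h2 := Int.emod_lt_of_pos (v i) hℓpos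
    refine ⟨by dsimp only; omega, hAB i hi, v i / ℓ, ?_⟩
    rw [hv i hi, Int.toNat_of_nonneg h1, Int.emod_add_mul_ediv]

namespace ModularSurface

/-- The points `x + j/(mℓ) + iy` with `j` in a fixed residue class modulo `m` are close to
`ℓ` equally spaced points on one closed horocycle. -/
theorem abs_sum_residue_class_le {m ℓ : ℕ} (hm : 0 < m) (hℓ : ℓ.Prime) (hℓm : ¬ ℓ ∣ m)
    {a q : ℤ} (hq : 0 < q) (hcop : IsCoprime (m * a) q) (hℓq : ¬ (ℓ : ℤ) ∣ q)
    {y θ : ℝ} (hy : 0 < y) (j₀ : ℕ) {Ψ : ModularSurface → ℝ} (hΨ : Continuous Ψ) {M ε h₀ : ℝ}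
    (hε : 0 ≤ ε) (hM : ∀ z, |Ψ z| ≤ M) (hh₀ : 0 < h₀) {C : ℝ}
    (hC : C = ((m / m.gcd j₀ : ℕ) : ℝ) * ℓ * q)
    (hclose : ∀ X : ℝ, |Ψ (realPoint (y / (C ^ 2 * (θ ^ 2 + y ^ 2)))
      (X + -(θ / (C ^ 2 * (θ ^ 2 + y ^ 2))))) - Ψ (realPoint h₀ X)| ≤ ε)
    (hunif : ∀ X u : ℝ, |u| ≤ 1 / ℓ →
      |Ψ (realPoint h₀ (X + u)) - Ψ (realPoint h₀ X)| ≤ ε) :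
    |∑ i ∈ Finset.range ℓ,
        Ψ (realPoint y (θ + a / (ℓ * q) + ((j₀ + m * i : ℕ) : ℝ) / ((m * ℓ : ℕ) : ℝ))) -
      ℓ * ∫ t in (0 : ℝ)..1, Ψ (realPoint h₀ t)| ≤ ℓ * (2 * ε) + 2 * M := by
  obtain ⟨m', hm'⟩ := Nat.gcd_dvd_left m j₀
  obtain ⟨j', hj'⟩ := Nat.gcd_dvd_right m j₀
  have hcop' : Nat.Coprime j' m' := by
    have := Nat.coprime_div_gcd_div_gcd (Nat.gcd_pos_of_pos_left j₀ hm)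
    rwa [Nat.div_eq_of_eq_mul_right (Nat.gcd_pos_of_pos_left j₀ hm) hm',
      Nat.div_eq_of_eq_mul_right (Nat.gcd_pos_of_pos_left j₀ hm) hj', Nat.coprime_comm] at this
  have hdpos : 0 < m.gcd j₀ := Nat.gcd_pos_of_pos_left j₀ hm
  have hmdiv : m / m.gcd j₀ = m' := Nat.div_eq_of_eq_mul_right hdpos hm'
  rw [hmdiv] at hC
  generalize m.gcd j₀ = d at *
  have hm'pos : 0 < m' := Nat.pos_of_ne_zero (by rintro rfl; omega)
  have hpr : Prime (ℓ : ℤ) := Nat.prime_iff_prime_int.mp hℓ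
  have hℓm' : ¬ (ℓ : ℤ) ∣ m' := fun h =>
    hℓm (hm' ▸ Dvd.dvd.mul_left (Int.natCast_dvd_natCast.mp h) d)
  have hℓD : ¬ (ℓ : ℤ) ∣ m' * q := fun h => (hpr.dvd_or_dvd h).elim hℓm' hℓq
  have hcq : IsCoprime (m : ℤ) q := hcop.of_mul_left_left
  have hc1 : IsCoprime (m' : ℤ) q := by
    rw [hm'] at hcq; push_cast at hcq; exact hcq.of_mul_left_right
  have hk : IsCoprime (m' * a + j' * q) (m' * q) := by
    refine IsCoprime.mul_right ?_ ?_
    · have h1 : IsCoprime ((j' : ℤ) * q) m' :=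
        (Nat.isCoprime_iff_coprime.mpr hcop').mul_left hc1.symm
      simpa [add_comm] using h1.add_mul_left_left a
    · have h1 : IsCoprime ((m' : ℤ) * a) q := hc1.mul_left hcop.of_mul_left_right
      simpa using h1.add_mul_right_left (j' : ℤ)
  obtain ⟨S, A, B, A₀, r, hS, hcard, hinj, hprop⟩ := exists_neg_inverses hℓ hℓD hk
  have hℓ0 : (0 : ℝ) < ℓ := by exact_mod_cast hℓ.pos
  have hq0 : (0 : ℝ) < q := by exact_mod_cast hq
  have hm0 : (0 : ℝ) < m' := by exact_mod_cast hm'pos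
  have hd0 : (0 : ℝ) < d := by exact_mod_cast hdpos
  have hmR : (m : ℝ) = d * m' := by exact_mod_cast hm'
  have hjR : (j₀ : ℝ) = d * j' := by exact_mod_cast hj'
  have hR := abs_sum_sub_integral_le (Φ := fun t => Ψ (realPoint h₀ t))
    (hΨ.comp (continuous_realPoint hh₀))
    (fun t => by simp only [realPoint_periodic h₀ t]) hℓ.pos hunif (A₀ / C)
  have hA := abs_sum_sub_sum_le_of_injOn hS hcard (fun i hi => (hprop i hi).1) hinj
    (f := fun i => Ψ (realPoint y (θ + a / (ℓ * q) + ((j₀ + m * i : ℕ) : ℝ) / ((m * ℓ : ℕ) : ℝ))))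
    (g := fun v => Ψ (realPoint h₀ (A₀ / C + v / ℓ))) (fun i => hM _) (fun i => hM _) hε (by
      intro i hi
      obtain ⟨-, hdet, t, ht⟩ := hprop i hi
      have hCint : (0 : ℤ) < m' * q * ℓ := by
        have := hℓ.pos
        positivity
      have h1 := realPoint_eq_of_det hdet hCint hy θ
      have eC : ((m' * q * ℓ : ℤ) : ℝ) = C := by rw [hC]; push_cast; ring
      have e1 : θ + a / (ℓ * q) + ((j₀ + m * i : ℕ) : ℝ) / ((m * ℓ : ℕ) : ℝ) =
          ((m' * a + j' * q + i * (m' * q) : ℤ) : ℝ) / ((m' * q * ℓ : ℤ) : ℝ) + θ := by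
        push_cast
        rw [hmR, hjR]
        field_simp
        ring
      have e2 : realPoint h₀ (A₀ / C + r i / ℓ) = realPoint h₀ (A i / C) := by
        have h2 := (realPoint_periodic h₀).int_mul t (A₀ / C + r i / ℓ)
        rw [← h2, ht, hC]
        congr 1
        push_cast
        field_simp
        ring
      rw [e1, h1, e2, eC, sub_eq_add_neg]
      exact hclose _)
  rw [abs_le] at hA hR ⊢
  constructor <;> linarith [hA.1, hA.2, hR.1, hR.2]

end ModularSurface

/-! ### Comparison of `δ_{n,x,y}` with `ν_{m,Y}` -/

theorem Finset.sum_range_mul_eq {M : Type*} [AddCommMonoid M] (f : ℕ → M) (m l : ℕ) :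
    ∑ j ∈ Finset.range (m * l), f j =
      ∑ j ∈ Finset.range m, ∑ i ∈ Finset.range l, f (j + m * i) := by
  rw [Finset.sum_comm]
  induction l with
  | zero => simp
  | succ l ih =>
    rw [Nat.mul_succ, Finset.sum_range_add, ih, Finset.sum_range_succ]
    simp only [add_comm]

/-- The real numbers `x` which are within `y / k` of a fraction `m a / (n q)`, where `q` is prime
to `n` and to `m a`, and `n² q² y Y` is within `1 / k` of `1`. Translating such an `x` by `j / n`
gives a point near the fraction `(m a + j q) / (n q)`; if `d` is the gcd of numerator and `n`, this
fraction has the reduced denominator `n q / d`, so that the height of a `Γ`-translate is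
`d² / (n² q² y)`, nearly `d² Y`. The numerator `m a` is taken divisible by `m` so that the gcd of
`m a + j q` and `m` is the gcd of `j` and `m`. -/
def approxSet (m : ℕ) (Y : ℝ) (k n : ℕ) (y : ℝ) : Set ℝ :=
  {x | ∃ a q : ℤ, 0 < q ∧ IsCoprime (m * a) q ∧ IsCoprime (n : ℤ) q ∧
    |(n : ℝ) ^ 2 * q ^ 2 * y * Y - 1| < 1 / (k : ℝ) ∧ |x - m * a / (n * q)| < y / (k : ℝ)}

namespace ModularSurface

theorem integral_delta {Ψ : ModularSurface → ℝ} (hΨ : Continuous Ψ) (n : ℕ) (x y : ℝ) :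
    ∫ z, Ψ z ∂(delta n (x : UnitAddCircle) y) =
      (n : ℝ)⁻¹ * ∑ j ∈ Finset.range n, Ψ (realPoint y (x + j / n)) := by
  rw [delta, integral_smul_measure, integral_finsetSum_measure]
  · have h : ∀ j : ℕ, point y ((x : UnitAddCircle) + ((j / n : ℝ) : UnitAddCircle)) =
        realPoint y (x + j / n) := fun j => rfl
    simp only [integral_dirac' _ _ hΨ.stronglyMeasurable, h, ENNReal.toReal_inv,
      ENNReal.toReal_natCast, smul_eq_mul]
  · exact fun j _ => integrable_dirac' hΨ.stronglyMeasurable (by simp)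

instance (Y : ℝ) : IsFiniteMeasure (horocycleMeasure Y) := by
  unfold horocycleMeasure; infer_instance

theorem isFiniteMeasure_nu {m : ℕ} (hm : 0 < m) (Y : ℝ) : IsFiniteMeasure (nu m Y) := by
  unfold nu
  have : ∀ d ∈ m.divisors,
      IsFiniteMeasure (((m / d).totient : ENNReal) • horocycleMeasure (d ^ 2 * Y)) :=
    fun d _ => Measure.smul_finite _ (ENNReal.natCast_ne_top _)
  have h2 : IsFiniteMeasure
      (∑ d ∈ m.divisors, ((m / d).totient : ENNReal) • horocycleMeasure (d ^ 2 * Y)) := by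
    refine ⟨?_⟩
    rw [Measure.finsetSum_apply]
    exact ENNReal.sum_lt_top.mpr fun d hd => (this d hd).measure_univ_lt_top
  exact Measure.smul_finite _ (by simp [hm.ne'])

theorem integral_horocycleMeasure {Ψ : ModularSurface → ℝ} (hΨ : Continuous Ψ) {Y : ℝ}
    (hY : 0 < Y) :
    ∫ z, Ψ z ∂(horocycleMeasure Y) = ∫ t in (0 : ℝ)..1, Ψ (realPoint Y t) := by
  rw [horocycleMeasure, integral_map (continuous_point hY).measurable.aemeasurable
    hΨ.aestronglyMeasurable, ← UnitAddCircle.intervalIntegral_preimage 0]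
  simp [point]

/-- The average over the divisors `d` of `m` with weights `φ(m / d)` is the average over the
residue classes `j` modulo `m`, with `d = gcd(m, j)`. -/
theorem integral_nu {Ψ : ModularSurface → ℝ} (hΨ : Continuous Ψ) {M : ℝ} (hM : ∀ z, |Ψ z| ≤ M)
    {m : ℕ} (hm : 0 < m) {Y : ℝ} (hY : 0 < Y) :
    ∫ z, Ψ z ∂(nu m Y) = (m : ℝ)⁻¹ * ∑ j ∈ Finset.range m,
      ∫ t in (0 : ℝ)..1, Ψ (realPoint ((m.gcd j : ℝ) ^ 2 * Y) t) := by
  have hint : ∀ d, Integrable Ψ (horocycleMeasure d) := fun d =>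
    Integrable.of_bound hΨ.aestronglyMeasurable M (Eventually.of_forall hM)
  rw [nu, integral_smul_measure, integral_finsetSum_measure]
  · have h1 : ∀ j ∈ Finset.range m, m.gcd j ∈ m.divisors := fun j _ =>
      Nat.mem_divisors.mpr ⟨Nat.gcd_dvd_left _ _, hm.ne'⟩
    rw [← Finset.sum_fiberwise_of_maps_to h1]
    simp only [ENNReal.toReal_inv, ENNReal.toReal_natCast, smul_eq_mul]
    congr 1
    refine Finset.sum_congr rfl fun d hd => ?_
    have hd' := Nat.mem_divisors.mp hd
    have hdpos : 0 < d := Nat.pos_of_mem_divisors hd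
    rw [integral_smul_measure, integral_horocycleMeasure hΨ (by positivity),
      Finset.sum_congr rfl (g := fun _ => ∫ t in (0 : ℝ)..1, Ψ (realPoint ((d : ℝ) ^ 2 * Y) t))
        (fun j hj => by rw [(Finset.mem_filter.mp hj).2]),
      Finset.sum_const, Nat.totient_div_of_dvd hd'.1]
    simp
  · exact fun d _ => (hint _).smul_measure (ENNReal.natCast_ne_top _)

/-- The constants `t` and `s` stand for `n² q² y Y` and `θ / y`, where `θ` is the distance of `x`
to the fraction in `approxSet`. -/
theorem eventually_close {Ψ : ModularSurface → ℝ} (hΨ : Continuous Ψ) {h₀ ε : ℝ}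
    (hh₀ : 0 < h₀) (hε : 0 < ε) (m : ℕ) :
    ∀ᶠ k : ℕ in atTop,
      (∀ t s : ℝ, |t - 1| < 1 / k → |s| < 1 / k → ∀ X : ℝ,
        |Ψ (realPoint (h₀ / (t * (1 + s ^ 2))) (X + -(h₀ * s / (t * (1 + s ^ 2))))) -
          Ψ (realPoint h₀ X)| ≤ ε) ∧
      ∀ X u : ℝ, |u| ≤ m / k → |Ψ (realPoint h₀ (X + u)) - Ψ (realPoint h₀ X)| ≤ ε := by
  obtain ⟨ρ, hρ, hρ'⟩ := exists_uniform_radius hΨ hh₀ hε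
  have hc : ∀ᶠ p : ℝ × ℝ in 𝓝 (1, 0), |-(h₀ * p.2 / (p.1 * (1 + p.2 ^ 2)))| < ρ ∧
      |h₀ / (p.1 * (1 + p.2 ^ 2)) - h₀| < ρ := by
    have c1 : ContinuousAt (fun p : ℝ × ℝ => |-(h₀ * p.2 / (p.1 * (1 + p.2 ^ 2)))|) (1, 0) := by
      refine ContinuousAt.abs (ContinuousAt.neg (ContinuousAt.div ?_ ?_ (by simp))) <;> fun_prop
    have c2 : ContinuousAt (fun p : ℝ × ℝ => |h₀ / (p.1 * (1 + p.2 ^ 2)) - h₀|) (1, 0) := by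
      refine ContinuousAt.abs (ContinuousAt.sub (ContinuousAt.div ?_ ?_ (by simp)) ?_) <;> fun_prop
    exact (c1.eventually_lt_const (by simpa using hρ)).and
      (c2.eventually_lt_const (by simpa using hρ))
  obtain ⟨η, hη, hball⟩ := Metric.eventually_nhds_iff.mp hc
  have h1 : ∀ᶠ k : ℕ in atTop, (1 : ℝ) / k < η :=
    tendsto_one_div_atTop_nhds_zero_nat.eventually_lt_const hη
  have h2 : ∀ᶠ k : ℕ in atTop, (m : ℝ) / k < ρ :=
    (tendsto_const_div_atTop_nhds_zero_nat (m : ℝ)).eventually_lt_const hρ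
  filter_upwards [h1, h2] with k hk1 hk2
  refine ⟨fun t s ht hs X => ?_, fun X u hu => ?_⟩
  · have := @hball (t, s) (by
      rw [Prod.dist_eq, max_lt_iff]
      exact ⟨by simpa [Real.dist_eq] using ht.trans hk1,
        by simpa [Real.dist_eq] using hs.trans hk1⟩)
    exact (hρ' _ _ this.1 this.2 X).le
  · exact (hρ' u h₀ (hu.trans_lt hk2) (by simpa using hρ) X).le

/-- Near the fractions used in `approxSet`, the measures `δ_{n,x,y}` are close to `ν_{m,Y}`. -/
theorem eventually_abs_integral_delta_sub_le {Ψ : ModularSurface → ℝ} (hΨ : Continuous Ψ) {M : ℝ}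
    (hM : ∀ z, |Ψ z| ≤ M) {m : ℕ} (hm : 0 < m) {Y : ℝ} (hY : 0 < Y) {ε : ℝ} (hε : 0 < ε) :
    ∀ᶠ k : ℕ in atTop, ∀ n ∈ primeMultiples m, k ≤ n → ∀ x y : ℝ, 0 < y →
      x ∈ approxSet m Y k n y →
      |∫ z, Ψ z ∂(delta n (x : UnitAddCircle) y) - ∫ z, Ψ z ∂(nu m Y)| ≤ ε := by
  have hm0 : (0 : ℝ) < m := by exact_mod_cast hm
  have hgcd : ∀ j, (0 : ℝ) < m.gcd j := fun j => by exact_mod_cast Nat.gcd_pos_of_pos_left j hm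
  have h1 := (Finset.range m).eventually_all.mpr fun j _ =>
    eventually_close hΨ (h₀ := (m.gcd j : ℝ) ^ 2 * Y) (by have := hgcd j; positivity)
      (by positivity : 0 < ε / 4) m
  have h2 : ∀ᶠ k : ℕ in atTop, 2 * M * m / k < ε / 2 :=
    (tendsto_const_div_atTop_nhds_zero_nat (2 * M * (m : ℝ))).eventually_lt_const (by positivity)
  filter_upwards [h1, h2, eventually_gt_atTop 0] with k hk1 hk2 hk0
  rintro n ⟨ℓ, hℓ, hℓm, rfl⟩ hkn x y hy ⟨a, q, hq, hcop, hcopn, ht, hx⟩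
  have hk0' : (0 : ℝ) < k := by exact_mod_cast hk0
  have hℓ0 : (0 : ℝ) < ℓ := by exact_mod_cast hℓ.pos
  have hq0 : (0 : ℝ) < q := by exact_mod_cast hq
  have hM0 : 0 ≤ M := (abs_nonneg _).trans (hM (mk I))
  have hknR : (k : ℝ) ≤ m * ℓ := by exact_mod_cast hkn
  have hℓk : 1 / (ℓ : ℝ) ≤ m / k := by
    rw [div_le_div_iff₀ hℓ0 hk0']; linarith
  have hℓq : ¬ (ℓ : ℤ) ∣ q := fun h => by
    push_cast at hcopn
    exact (Nat.prime_iff_prime_int.mp hℓ).not_isUnit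
      (hcopn.of_mul_left_right.isUnit_of_dvd' dvd_rfl h)
  set θ := x - m * a / (((m * ℓ : ℕ) : ℝ) * q) with hθ
  have hxθ : x = θ + a / (ℓ * q) := by
    rw [hθ]; push_cast; field_simp; ring
  have key : ∀ j ∈ Finset.range m, |∑ i ∈ Finset.range ℓ,
        Ψ (realPoint y (x + ((j + m * i : ℕ) : ℝ) / ((m * ℓ : ℕ) : ℝ))) -
      ℓ * ∫ t in (0 : ℝ)..1, Ψ (realPoint ((m.gcd j : ℝ) ^ 2 * Y) t)| ≤
        ℓ * (2 * (ε / 4)) + 2 * M := by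
    intro j hj
    have hg := hgcd j
    obtain ⟨hc1, hc2⟩ := hk1 j hj
    have hdiv : ((m / m.gcd j : ℕ) : ℝ) = m / m.gcd j :=
      Nat.cast_div (Nat.gcd_dvd_left m j) hg.ne'
    rw [hxθ]
    refine abs_sum_residue_class_le hm hℓ hℓm hq hcop hℓq hy j hΨ (by positivity) hM
      (by positivity) rfl ?_ fun X u hu => hc2 X u (hu.trans hℓk)
    intro X
    have hs : |θ / y| < 1 / k := by
      rw [abs_div, abs_of_pos hy, div_lt_iff₀ hy]
      calc |θ| < y / k := hx
        _ = 1 / k * y := by ring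
    have hN : θ ^ 2 + y ^ 2 ≠ 0 := by positivity
    have hs2 : 1 + (θ / y) ^ 2 = (θ ^ 2 + y ^ 2) / y ^ 2 := by field_simp; ring
    have h := hc1 _ _ ht hs X
    have e1 : y / ((((m / m.gcd j : ℕ) : ℝ) * ℓ * q) ^ 2 * (θ ^ 2 + y ^ 2)) =
        (m.gcd j : ℝ) ^ 2 * Y /
          (((m * ℓ : ℕ) : ℝ) ^ 2 * (q : ℝ) ^ 2 * y * Y * (1 + (θ / y) ^ 2)) := by
      rw [hdiv, hs2]; push_cast; field_simp
    have e2 : θ / ((((m / m.gcd j : ℕ) : ℝ) * ℓ * q) ^ 2 * (θ ^ 2 + y ^ 2)) =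
        (m.gcd j : ℝ) ^ 2 * Y * (θ / y) /
          (((m * ℓ : ℕ) : ℝ) ^ 2 * (q : ℝ) ^ 2 * y * Y * (1 + (θ / y) ^ 2)) := by
      rw [hdiv, hs2]; push_cast; field_simp
    rwa [e1, e2]
  rw [integral_delta hΨ, integral_nu hΨ hM hm hY, Finset.sum_range_mul_eq]
  have e : ∀ u v : ℝ, ((m * ℓ : ℕ) : ℝ)⁻¹ * u - (m : ℝ)⁻¹ * v =
      ((m * ℓ : ℕ) : ℝ)⁻¹ * (u - ℓ * v) := by
    intro u v; push_cast; field_simp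
  rw [e, Finset.mul_sum, ← Finset.sum_sub_distrib, abs_mul,
    abs_of_pos (by push_cast; positivity : 0 < ((m * ℓ : ℕ) : ℝ)⁻¹)]
  have hsum := (Finset.abs_sum_le_sum_abs _ _).trans (Finset.sum_le_sum key)
  rw [Finset.sum_const, Finset.card_range, nsmul_eq_mul] at hsum
  calc _ ≤ ((m * ℓ : ℕ) : ℝ)⁻¹ * (m * (ℓ * (2 * (ε / 4)) + 2 * M)) := by gcongr
    _ = ε / 2 + 2 * M * (1 / ℓ) := by push_cast; field_simp; ring
    _ ≤ ε / 2 + 2 * M * (m / k) := by gcongr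
    _ = ε / 2 + 2 * M * m / k := by ring
    _ ≤ ε := by linarith

end ModularSurface

/-! ### Successive choice of the heights -/

theorem isOpen_approxSet (m : ℕ) (Y : ℝ) (k n : ℕ) (y : ℝ) : IsOpen (approxSet m Y k n y) := by
  simp only [approxSet, Set.ofPred_exists]
  refine isOpen_iUnion fun a => isOpen_iUnion fun q => ?_
  simp only [Set.ofPred_and]
  refine isOpen_const.inter (isOpen_const.inter (isOpen_const.inter (isOpen_const.inter ?_)))
  exact isOpen_lt (by fun_prop) continuous_const

/-- A form of the divergence half of the Borel–Cantelli lemma. The parameters `y n` are chosen one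
after the other, each so small that `A k n (y n)` covers at least the proportion `p k n` of what
the earlier sets have left uncovered. -/
theorem exists_seq_ae_forall_exists_mem {P : Set ℕ} {A : ℕ → ℕ → ℝ → Set ℝ}
    (hopen : ∀ k n y, IsOpen (A k n y)) {p : ℕ → ℕ → ℝ} (hp : ∀ k n, 0 ≤ p k n) {k₀ : ℕ}
    (hA : ∀ k, k₀ ≤ k → ∀ n ∈ P, k ≤ n → ∀ B : Set ℝ, IsCompact B → B ⊆ Set.Icc 0 1 →
      ∀ᶠ y in 𝓝[>] (0 : ℝ), p k n * volume.real B ≤ volume.real (B ∩ A k n y))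
    (hdiv : ∀ k, k₀ ≤ k → ¬ Summable (Set.indicator {n | k ≤ n ∧ n ∈ P} (p k)))
    {c : ℕ → ℝ} (hc : ∀ n ∈ P, 0 < c n) :
    ∃ y : ℕ → ℝ, (∀ n ∈ P, 0 < y n ∧ y n < c n) ∧
      ∀ᵐ x : ℝ, x ∈ Set.Icc (0 : ℝ) 1 → ∀ k, k₀ ≤ k → ∃ n ∈ P, k ≤ n ∧ x ∈ A k n (y n) := by
  classical
  -- the state before step `n`: for each `k`, the part of `[0, 1]` which is not yet covered
  let σ := ℕ → {B : Set ℝ // IsCompact B ∧ B ⊆ Set.Icc (0 : ℝ) 1}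
  have hstep : ∀ (n : ℕ) (B : σ), ∃ v : ℝ, n ∈ P → 0 < v ∧ v < c n ∧ ∀ k ∈ Finset.Icc k₀ n,
      p k n * volume.real (B k).1 ≤ volume.real ((B k).1 ∩ A k n v) := by
    intro n B
    by_cases hn : n ∈ P
    · have h1 : ∀ᶠ v in 𝓝[>] (0 : ℝ), ∀ k ∈ Finset.Icc k₀ n,
          p k n * volume.real (B k).1 ≤ volume.real ((B k).1 ∩ A k n v) :=
        (Finset.eventually_all _).mpr fun k hk =>
          hA k (Finset.mem_Icc.mp hk).1 n hn (Finset.mem_Icc.mp hk).2 _ (B k).2.1 (B k).2.2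
      have h2 : ∀ᶠ v in 𝓝[>] (0 : ℝ), v ∈ Set.Ioo 0 (c n) := Ioo_mem_nhdsGT (hc n hn)
      obtain ⟨v, hv1, hv2⟩ := (h1.and h2).exists
      exact ⟨v, fun _ => ⟨hv2.1, hv2.2, hv1⟩⟩
    · exact ⟨0, fun h => absurd h hn⟩
  choose F hF using hstep
  let upd : ℕ → σ → σ := fun n B k => if k ≤ n ∧ n ∈ P then
    ⟨(B k).1 \ A k n (F n B), (B k).2.1.diff (hopen _ _ _), Set.sdiff_subset.trans (B k).2.2⟩ else B k
  let D : ℕ → σ := fun n => Nat.rec (fun _ => ⟨Set.Icc 0 1, isCompact_Icc, subset_rfl⟩) upd n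
  have hD0 : ∀ k, (D 0 k).1 = Set.Icc 0 1 := fun k => rfl
  have hDs : ∀ n, D (n + 1) = upd n (D n) := fun n => rfl
  refine ⟨fun n => F n (D n), fun n hn => ⟨(hF n (D n) hn).1, (hF n (D n) hn).2.1⟩, ?_⟩
  have hsucc : ∀ n k, k ≤ n ∧ n ∈ P → (D (n + 1) k).1 = (D n k).1 \ A k n (F n (D n)) := by
    intro n k h
    rw [hDs]
    simp only [upd, if_pos h]
  have hsucc' : ∀ n k, ¬ (k ≤ n ∧ n ∈ P) → D (n + 1) k = D n k := by
    intro n k h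
    rw [hDs]
    simp only [upd, if_neg h]
  have hfin : ∀ n k, volume (D n k).1 ≠ ⊤ := fun n k => (D n k).2.1.measure_lt_top.ne
  have hnull : ∀ k, k₀ ≤ k → volume (⋂ n, (D n k).1) = 0 := by
    intro k hk
    by_contra hne
    have hfinI : volume (⋂ n, (D n k).1) ≠ ⊤ :=
      ne_top_of_le_ne_top (hfin 0 k) (measure_mono (Set.iInter_subset _ 0))
    set β := volume.real (⋂ n, (D n k).1) with hβ
    have hβ0 : 0 < β := ENNReal.toReal_pos hne hfinI
    have hβle : ∀ n, β ≤ volume.real (D n k).1 := fun n =>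
      measureReal_mono (Set.iInter_subset _ n) (hfin n k)
    -- each step removes measure at least `p k n * β`, which contradicts the divergence
    have hdec : ∀ n, volume.real (D (n + 1) k).1 + Set.indicator {n | k ≤ n ∧ n ∈ P} (p k) n * β ≤
        volume.real (D n k).1 := by
      intro n
      by_cases h : k ≤ n ∧ n ∈ P
      · rw [Set.indicator_of_mem (show n ∈ {n | k ≤ n ∧ n ∈ P} from h), hsucc n k h]
        have h1 := (hF n (D n) h.2).2.2 k (Finset.mem_Icc.mpr ⟨hk, h.1⟩)
        have h2 := measureReal_sdiff_add_inter (μ := volume) (s := (D n k).1)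
          (hopen k n (F n (D n))).measurableSet (hfin n k)
        have h3 := mul_le_mul_of_nonneg_left (hβle n) (hp k n)
        linarith
      · rw [Set.indicator_of_notMem (show n ∉ {n | k ≤ n ∧ n ∈ P} from h), hsucc' n k h]
        simp
    have hsum : ∀ N, ∑ n ∈ Finset.range N, Set.indicator {n | k ≤ n ∧ n ∈ P} (p k) n * β ≤
        volume.real (D 0 k).1 - volume.real (D N k).1 := by
      intro N
      induction N with
      | zero => simp
      | succ N ih =>
        rw [Finset.sum_range_succ]
        linarith [hdec N]
    refine hdiv k hk ((summable_mul_right_iff hβ0.ne').mp ?_)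
    refine summable_of_sum_range_le (c := volume.real (D 0 k).1) (fun n => ?_) fun N => ?_
    · exact mul_nonneg (Set.indicator_nonneg (fun n _ => hp k n) n) hβ0.le
    · linarith [hsum N, measureReal_nonneg (μ := volume) (s := (D N k).1)]
  have hae : ∀ᵐ x : ℝ, ∀ k, k₀ ≤ k → x ∉ ⋂ n, (D n k).1 := by
    rw [ae_all_iff]
    intro k
    rw [ae_all_iff]
    intro hk
    exact measure_eq_zero_iff_ae_notMem.mp (hnull k hk)
  filter_upwards [hae] with x hx hx01 k hk
  by_contra! hcon
  refine hx k hk (Set.mem_iInter.mpr fun n => ?_)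
  induction n with
  | zero => exact hx01
  | succ n ih =>
    by_cases h : k ≤ n ∧ n ∈ P
    · rw [hsucc n k h]
      exact ⟨ih, hcon n h.2 h.1⟩
    · rwa [hsucc' n k h]

theorem not_summable_indicator_primeMultiples {m : ℕ} (hm : 0 < m) (k : ℕ) {b : ℝ} (hb : 0 < b) :
    ¬ Summable (Set.indicator {n | k ≤ n ∧ n ∈ primeMultiples m} fun n : ℕ => b / (n : ℝ)) := by
  intro h
  have hm0 : (0 : ℝ) < m := by exact_mod_cast hm
  have h1 := (h.comp_injective (mul_right_injective₀ hm.ne')).mul_left (m / b)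
  refine not_summable_one_div_on_primes (Summable.of_norm_bounded_eventually_nat h1 ?_)
  filter_upwards [eventually_gt_atTop m, eventually_gt_atTop k] with ℓ hℓm hℓk
  by_cases hℓ : ℓ.Prime
  · have hℓ0 : (0 : ℝ) < ℓ := by exact_mod_cast hℓ.pos
    have hmem : m * ℓ ∈ {n | k ≤ n ∧ n ∈ primeMultiples m} :=
      ⟨by nlinarith, ℓ, hℓ, fun hd => absurd (Nat.le_of_dvd hm hd) (by omega), rfl⟩
    simp only [Function.comp_apply]
    rw [Set.indicator_of_mem (show ℓ ∈ {p : ℕ | p.Prime} from hℓ), Set.indicator_of_mem hmem,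
      Real.norm_of_nonneg (by positivity)]
    push_cast
    refine le_of_eq ?_
    field_simp
  · rw [Set.indicator_of_notMem (show ℓ ∉ {p : ℕ | p.Prime} from hℓ), norm_zero]
    refine mul_nonneg (by positivity) (Set.indicator_nonneg (fun n _ => by positivity) _)

/-! ### Counting fractions with a sieve -/

theorem abs_card_filter_modEq_sub_le {u v : ℝ} (huv : u ≤ v) {r : ℤ} (hr : 0 < r) (w : ℤ) :
    |(({x ∈ Finset.Ioc ⌊u⌋ ⌊v⌋ | x ≡ w [ZMOD r]}.card : ℕ) : ℝ) - (v - u) / r| ≤ 2 := by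
  have hr1 : (1 : ℝ) ≤ r := by exact_mod_cast hr
  have hr0 : (0 : ℝ) < r := by linarith
  have hle : ⌊u⌋ ≤ ⌊v⌋ := Int.floor_le_floor huv
  have h := Int.Ioc_filter_modEq_card ⌊u⌋ ⌊v⌋ hr w
  rw [max_eq_left (by
    rw [sub_nonneg]
    refine Int.floor_le_floor ?_
    have hr' : (0 : ℚ) < r := by exact_mod_cast hr
    gcongr)] at h
  have key : ∀ z : ℤ, (z : ℝ) / r - 1 < ⌊(z : ℚ) / r⌋ ∧ (⌊(z : ℚ) / r⌋ : ℝ) ≤ z / r := by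
    intro z
    have h1 := Int.sub_one_lt_floor ((z : ℚ) / r)
    have h2 := Int.floor_le ((z : ℚ) / r)
    have h1' : (((z : ℚ) / r - 1 : ℚ) : ℝ) < ((⌊(z : ℚ) / r⌋ : ℚ) : ℝ) := by exact_mod_cast h1
    have h2' : ((⌊(z : ℚ) / r⌋ : ℚ) : ℝ) ≤ (((z : ℚ) / r : ℚ) : ℝ) := by exact_mod_cast h2
    push_cast at h1' h2'
    exact ⟨h1', h2'⟩
  have hcard : (({x ∈ Finset.Ioc ⌊u⌋ ⌊v⌋ | x ≡ w [ZMOD r]}.card : ℕ) : ℝ) =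
      ⌊((⌊v⌋ - w : ℤ) : ℚ) / r⌋ - ⌊((⌊u⌋ - w : ℤ) : ℚ) / r⌋ := by
    push_cast
    exact_mod_cast h
  obtain ⟨a1, a2⟩ := key (⌊v⌋ - w)
  obtain ⟨b1, b2⟩ := key (⌊u⌋ - w)
  rw [hcard]
  have hu1 := Int.sub_one_lt_floor u
  have hu2 := Int.floor_le u
  have hv1 := Int.sub_one_lt_floor v
  have hv2 := Int.floor_le v
  have e : ((⌊v⌋ - w : ℤ) : ℝ) / r - ((⌊u⌋ - w : ℤ) : ℝ) / r = ((⌊v⌋ : ℝ) - ⌊u⌋) / r := by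
    push_cast; field_simp; ring
  have d1 : ((⌊v⌋ : ℝ) - ⌊u⌋) / r ≤ (v - u) / r + 1 := by
    rw [div_add_one hr0.ne']; gcongr; linarith
  have d2 : (v - u) / r - 1 ≤ ((⌊v⌋ : ℝ) - ⌊u⌋) / r := by
    rw [sub_le_iff_le_add, div_add_one hr0.ne']; gcongr; linarith
  rw [abs_le]
  constructor <;> linarith

theorem card_filter_dvd_le {u v : ℝ} (huv : u ≤ v) {r : ℤ} (hr : 0 < r) :
    (({x ∈ Finset.Ioc ⌊u⌋ ⌊v⌋ | r ∣ x}.card : ℕ) : ℝ) ≤ (v - u) / r + 2 := by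
  have h := (abs_le.mp (abs_card_filter_modEq_sub_le huv hr 0)).2
  simp only [Int.modEq_zero_iff_dvd] at h
  linarith

/-- If some `x ≡ 1` modulo `m` is divisible by `r`, then `m` and `r` are coprime, so that the two
conditions amount to a single congruence modulo `m r`. -/
theorem card_filter_modEq_one_dvd_le {u v : ℝ} (huv : u ≤ v) {m r : ℤ} (hm : 0 < m) (hr : 0 < r) :
    (({x ∈ {x ∈ Finset.Ioc ⌊u⌋ ⌊v⌋ | x ≡ 1 [ZMOD m]} | r ∣ x}.card : ℕ) : ℝ) ≤
      (v - u) / m / r + 2 := by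
  have hm0 : (0 : ℝ) < m := by exact_mod_cast hm
  have hr0 : (0 : ℝ) < r := by exact_mod_cast hr
  rcases ({x ∈ {x ∈ Finset.Ioc ⌊u⌋ ⌊v⌋ | x ≡ 1 [ZMOD m]} | r ∣ x}).eq_empty_or_nonempty with h | h
  · rw [h, Finset.card_empty, Nat.cast_zero]
    have : 0 ≤ v - u := by linarith
    positivity
  · obtain ⟨q₀, hq₀⟩ := h
    simp only [Finset.mem_filter] at hq₀
    have hsub : {x ∈ {x ∈ Finset.Ioc ⌊u⌋ ⌊v⌋ | x ≡ 1 [ZMOD m]} | r ∣ x} ⊆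
        {x ∈ Finset.Ioc ⌊u⌋ ⌊v⌋ | x ≡ q₀ [ZMOD (m * r)]} := by
      intro x hx
      simp only [Finset.mem_filter] at hx ⊢
      refine ⟨hx.1.1, ?_⟩
      have hcop : m.natAbs.Coprime r.natAbs := by
        rw [← Int.isCoprime_iff_nat_coprime]
        obtain ⟨t, ht⟩ := hx.1.2.dvd
        obtain ⟨s, hs⟩ := hx.2
        exact ⟨t, s, by linear_combination -ht - hs⟩
      refine (Int.modEq_and_modEq_iff_modEq_mul hcop).mp ⟨hx.1.2.trans hq₀.1.2.symm, ?_⟩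
      exact ((Int.modEq_zero_iff_dvd).mpr hx.2).trans ((Int.modEq_zero_iff_dvd).mpr hq₀.2).symm
    have h := (abs_le.mp (abs_card_filter_modEq_sub_le huv (mul_pos hm hr) q₀)).2
    have h2 : (({x ∈ {x ∈ Finset.Ioc ⌊u⌋ ⌊v⌋ | x ≡ 1 [ZMOD m]} | r ∣ x}.card : ℕ) : ℝ) ≤
      (({x ∈ Finset.Ioc ⌊u⌋ ⌊v⌋ | x ≡ q₀ [ZMOD (m * r)]}.card : ℕ) : ℝ) := by
      exact_mod_cast Finset.card_le_card hsub
    have e : (v - u) / m / r = (v - u) / ((m * r : ℤ) : ℝ) := by push_cast; rw [div_div]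
    rw [e]
    linarith

theorem sum_Icc_one_div_sq_le (R : ℕ) : ∑ r ∈ Finset.Icc 2 R, (1 : ℝ) / (r : ℝ) ^ 2 ≤ 3 / 4 := by
  have h : ∀ s : ℕ, ∑ r ∈ Finset.Icc 2 (s + 2), (1 : ℝ) / (r : ℝ) ^ 2 ≤ 3 / 4 - 1 / (s + 2 : ℕ) := by
    intro s
    induction s with
    | zero => norm_num
    | succ s ih =>
      rw [show s + 1 + 2 = (s + 2) + 1 by ring, Finset.sum_Icc_succ_top (by omega)]
      have : (1 : ℝ) / ((s + 2 + 1 : ℕ) : ℝ) ^ 2 ≤ 1 / (s + 2 : ℕ) - 1 / (s + 2 + 1 : ℕ) := by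
        push_cast
        have hs : (0 : ℝ) ≤ s := Nat.cast_nonneg s
        rw [div_sub_div _ _ (by positivity) (by positivity), div_le_div_iff₀ (by positivity)
          (by positivity)]
        nlinarith [sq_nonneg ((s : ℝ) + 2)]
      linarith
  rcases Nat.lt_or_ge R 2 with hR | hR
  · rw [Finset.Icc_eq_empty (by omega)]; norm_num
  · obtain ⟨s, rfl⟩ := Nat.exists_eq_add_of_le' hR
    have : (0 : ℝ) ≤ 1 / (s + 2 : ℕ) := by positivity
    linarith [h s]

/-- The pairs `(q, a)` with `a / q` in `(τ, τ + lam]` in lowest terms and with `q` in the window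
`(Q, (1 + ε) Q]`, congruent to `1` modulo `m` and not divisible by `ℓ`. -/
noncomputable def fractionPairs (m ℓ : ℕ) (ε lam Q τ : ℝ) : Finset (Σ _ : ℤ, ℤ) :=
  open Classical in
  (({q ∈ Finset.Ioc ⌊Q⌋ ⌊(1 + ε) * Q⌋ | q ≡ 1 [ZMOD m]}).sigma
    fun q => Finset.Ioc ⌊τ * q⌋ ⌊(τ + lam) * q⌋).filter fun z => ¬ (ℓ : ℤ) ∣ z.1 ∧ IsCoprime z.2 z.1

/-- The sieve: from all pairs, those with `ℓ ∣ q` and, for each `r ≥ 2`, those with `r ∣ a` and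
`r ∣ q` are removed. -/
theorem le_card_fractionPairs {m ℓ : ℕ} (hm : 0 < m) (hℓ : 0 < ℓ) {ε lam Q : ℝ} (hε : 0 < ε)
    (hlam : 0 < lam) (hQ : 1 ≤ Q) (hlamQ : 2 ≤ lam * Q) (τ : ℝ) :
    (ε * Q / m - 2) * (lam * Q - 2) - (ε * Q / m / ℓ + 2) * (lam * ((1 + ε) * Q) + 2) -
      ∑ r ∈ Finset.Icc 2 ⌊(1 + ε) * Q⌋₊,
        (ε * Q / m / r + 2) * (lam * ((1 + ε) * Q) / r + 2) ≤
      ((fractionPairs m ℓ ε lam Q τ).card : ℝ) := by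
  classical
  set W : Finset ℤ := {q ∈ Finset.Ioc ⌊Q⌋ ⌊(1 + ε) * Q⌋ | q ≡ 1 [ZMOD m]} with hW
  set J : ℤ → Finset ℤ := fun q => Finset.Ioc ⌊τ * q⌋ ⌊(τ + lam) * q⌋ with hJ
  have hQ0 : 0 < Q := by linarith
  have hm0 : (0 : ℝ) < m := by exact_mod_cast hm
  have hmZ : (0 : ℤ) < m := by exact_mod_cast hm
  have hQle : Q ≤ (1 + ε) * Q := by nlinarith
  have hwin : ∀ q ∈ W, Q < q ∧ (q : ℝ) ≤ (1 + ε) * Q := by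
    intro q hq
    have h := Finset.mem_Ioc.mp (Finset.mem_filter.mp hq).1
    exact ⟨Int.floor_lt.mp h.1, Int.le_floor.mp h.2⟩
  have hlen : (1 + ε) * Q - Q = ε * Q := by ring
  have hJle : ∀ q ∈ W, τ * q ≤ (τ + lam) * q := fun q hq => by
    have := (hwin q hq).1
    nlinarith
  have hJr : ∀ q ∈ W, ∀ r : ℤ, 0 < r →
      ((({a ∈ J q | r ∣ a} : Finset ℤ).card : ℕ) : ℝ) ≤ lam * ((1 + ε) * Q) / r + 2 := by
    intro q hq r hr
    refine (card_filter_dvd_le (hJle q hq) hr).trans ?_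
    have hr0 : (0 : ℝ) < r := by exact_mod_cast hr
    have : (τ + lam) * q - τ * q = lam * q := by ring
    rw [this]
    gcongr
    exact (hwin q hq).2
  have hWr : ∀ r : ℤ, 0 < r → ((({q ∈ W | r ∣ q} : Finset ℤ).card : ℕ) : ℝ) ≤
      ε * Q / m / r + 2 := by
    intro r hr
    have := card_filter_modEq_one_dvd_le hQle hmZ hr
    rwa [hlen] at this
  have hbad : ∀ r : ℤ, 0 < r →
      (((({q ∈ W | r ∣ q}).sigma fun q => {a ∈ J q | r ∣ a}).card : ℕ) : ℝ) ≤
        (ε * Q / m / r + 2) * (lam * ((1 + ε) * Q) / r + 2) := by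
    intro r hr
    have hr0 : (0 : ℝ) < r := by exact_mod_cast hr
    rw [Finset.card_sigma, Nat.cast_sum]
    refine (Finset.sum_le_card_nsmul _ _ _ fun q hq =>
      hJr q (Finset.mem_filter.mp hq).1 r hr).trans ?_
    rw [nsmul_eq_mul]
    have := hWr r hr
    gcongr
  have hbadℓ : (((({q ∈ W | (ℓ : ℤ) ∣ q}).sigma J).card : ℕ) : ℝ) ≤
      (ε * Q / m / ℓ + 2) * (lam * ((1 + ε) * Q) + 2) := by
    rw [Finset.card_sigma, Nat.cast_sum]
    refine (Finset.sum_le_card_nsmul _ _ (lam * ((1 + ε) * Q) + 2) fun q hq => ?_).trans ?_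
    · simpa using hJr q (Finset.mem_filter.mp hq).1 1 one_pos
    · rw [nsmul_eq_mul]
      have := hWr ℓ (by exact_mod_cast hℓ)
      push_cast at this
      gcongr
  have hall : (ε * Q / m - 2) * (lam * Q - 2) ≤ ((W.sigma J).card : ℝ) := by
    have hWc : ε * Q / m - 2 ≤ (W.card : ℝ) := by
      have := (abs_le.mp (abs_card_filter_modEq_sub_le hQle hmZ 1)).1
      rw [hlen] at this
      push_cast at this
      linarith
    rw [Finset.card_sigma, Nat.cast_sum]
    refine le_trans ?_ (Finset.card_nsmul_le_sum _ _ (lam * Q - 2) fun q hq => ?_)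
    · rw [nsmul_eq_mul]
      exact mul_le_mul_of_nonneg_right hWc (by linarith)
    · have h1 := (abs_le.mp (abs_card_filter_modEq_sub_le (hJle q hq) one_pos 0)).1
      simp only [Int.modEq_one, Finset.filter_true] at h1
      have h2 := (hwin q hq).1
      push_cast at h1
      have h3 : lam * Q ≤ lam * q := by gcongr
      change _ ≤ ((Finset.Ioc ⌊τ * q⌋ ⌊(τ + lam) * q⌋).card : ℝ)
      linarith
  have hcover : W.sigma J ⊆ fractionPairs m ℓ ε lam Q τ ∪
      ((({q ∈ W | (ℓ : ℤ) ∣ q}).sigma J) ∪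
        (Finset.Icc 2 ⌊(1 + ε) * Q⌋₊).biUnion fun r =>
          ({q ∈ W | (r : ℤ) ∣ q}).sigma fun q => {a ∈ J q | (r : ℤ) ∣ a}) := by
    rintro ⟨q, a⟩ hz
    obtain ⟨hq, ha⟩ := Finset.mem_sigma.mp hz
    by_cases h1 : (ℓ : ℤ) ∣ q
    · refine Finset.mem_union_right _ (Finset.mem_union_left _ ?_)
      exact Finset.mem_sigma.mpr ⟨Finset.mem_filter.mpr ⟨hq, h1⟩, ha⟩
    by_cases h2 : IsCoprime a q
    · refine Finset.mem_union_left _ ?_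
      rw [fractionPairs, Finset.mem_filter]
      exact ⟨hz, h1, h2⟩
    · refine Finset.mem_union_right _ (Finset.mem_union_right _ ?_)
      rw [Finset.mem_biUnion]
      have hq0 : 0 < q := by
        have := (hwin q hq).1
        exact_mod_cast hQ0.trans this
      have hg0 : Int.gcd a q ≠ 0 := by
        rw [Ne, Int.gcd_eq_zero_iff]; omega
      have hg1 : Int.gcd a q ≠ 1 := fun h => h2 (Int.isCoprime_iff_gcd_eq_one.mpr h)
      refine ⟨Int.gcd a q, Finset.mem_Icc.mpr ⟨by omega, Nat.le_floor ?_⟩, ?_⟩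
      · have h3 : (Int.gcd a q : ℤ) ≤ q := Int.le_of_dvd hq0 (Int.gcd_dvd_right a q)
        have h4 : ((Int.gcd a q : ℤ) : ℝ) ≤ q := by exact_mod_cast h3
        exact_mod_cast h4.trans (hwin q hq).2
      · exact Finset.mem_sigma.mpr ⟨Finset.mem_filter.mpr ⟨hq, Int.gcd_dvd_right a q⟩,
          Finset.mem_filter.mpr ⟨ha, Int.gcd_dvd_left a q⟩⟩
  have hcard := (Finset.card_le_card hcover).trans ((Finset.card_union_le _ _).trans
    (Nat.add_le_add_left ((Finset.card_union_le _ _).trans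
      (Nat.add_le_add_left Finset.card_biUnion_le _)) _))
  have hcard' : ((W.sigma J).card : ℝ) ≤ (fractionPairs m ℓ ε lam Q τ).card +
      (((({q ∈ W | (ℓ : ℤ) ∣ q}).sigma J).card : ℝ) +
        ∑ r ∈ Finset.Icc 2 ⌊(1 + ε) * Q⌋₊,
          ((({q ∈ W | (r : ℤ) ∣ q}).sigma fun q => {a ∈ J q | (r : ℤ) ∣ a}).card : ℝ)) := by
    exact_mod_cast hcard
  have hsum := Finset.sum_le_sum fun r (hr : r ∈ Finset.Icc 2 ⌊(1 + ε) * Q⌋₊) =>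
    hbad (r : ℤ) (by have := (Finset.mem_Icc.mp hr).1; omega)
  simp only [Int.cast_natCast] at hsum
  linarith

/-- A positive proportion of the pairs `(q, a)` survives the sieve, because
`∑_{r ≥ 2} 1 / r² ≤ 3 / 4 < 1`; the bound is uniform in the position `τ` of the interval. -/
theorem eventually_le_card_fractionPairs {m ℓ : ℕ} (hm : 0 < m) (hℓ : 11 ≤ ℓ) {ε lam : ℝ}
    (hε : 0 < ε) (hε1 : ε ≤ 1 / 30) (hlam : 0 < lam) :
    ∀ᶠ Q : ℝ in atTop, ∀ τ : ℝ,
      ε * lam * Q ^ 2 / (20 * m) ≤ ((fractionPairs m ℓ ε lam Q τ).card : ℝ) := by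
  have hm0 : (0 : ℝ) < m := by exact_mod_cast hm
  have hℓ0 : (11 : ℝ) ≤ ℓ := by exact_mod_cast hℓ
  set e := ε / m with he
  have he0 : 0 < e := by positivity
  set l := lam * (1 + ε) with hl
  have hl0 : 0 < l := by positivity
  set κ := e * lam * (6 / 100) / (e + l) ^ 2 with hκ
  have hκ0 : 0 < κ := by positivity
  have hκe : κ * (e + l) ^ 2 = e * lam * (6 / 100) := by rw [hκ]; field_simp
  have hll : l ≤ lam * (31 / 30) := by rw [hl]; gcongr; linarith
  set β := 2 * (e + lam) + 2 * (e + l) + 2 * (4 + 1 / κ) with hβ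
  have hβ0 : 0 < β := by positivity
  filter_upwards [eventually_ge_atTop 1, eventually_ge_atTop (2 / lam),
    eventually_ge_atTop ((β + 8) / (e * lam * (3 / 100)))] with Q hQ1 hQ2 hQ3 τ
  have hQ0 : 0 < Q := by linarith
  have h2 : 2 ≤ lam * Q := by
    rw [div_le_iff₀ hlam] at hQ2; linarith
  refine le_trans ?_ (le_card_fractionPairs hm (by omega) hε hlam hQ1 h2 τ)
  have e1 : ε * Q / m = e * Q := by rw [he]; ring
  have e2 : lam * ((1 + ε) * Q) = l * Q := by rw [hl]; ring
  rw [e1, e2]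
  have hsum : ∑ r ∈ Finset.Icc 2 ⌊(1 + ε) * Q⌋₊, (e * Q / r + 2) * (l * Q / r + 2) ≤
      3 / 4 * ((e * l + κ * (e + l) ^ 2) * Q ^ 2) + 2 * (4 + 1 / κ) * Q := by
    have hterm : ∀ r ∈ Finset.Icc 2 ⌊(1 + ε) * Q⌋₊, (e * Q / r + 2) * (l * Q / r + 2) ≤
        (e * l + κ * (e + l) ^ 2) * Q ^ 2 * (1 / (r : ℝ) ^ 2) + (4 + 1 / κ) := by
      intro r hr
      have hr0 : (0 : ℝ) < r := by
        have := (Finset.mem_Icc.mp hr).1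
        exact_mod_cast (by omega : 0 < r)
      -- the arithmetic-geometric mean inequality, applied to the mixed term
      have hamgm : 2 * ((e + l) * Q / r) ≤ κ * ((e + l) * Q / r) ^ 2 + 1 / κ := by
        have h := sq_nonneg (κ * ((e + l) * Q / r) - 1)
        have h' : 0 ≤ (κ * ((e + l) * Q / r) - 1) ^ 2 / κ := by positivity
        have : (κ * ((e + l) * Q / r) - 1) ^ 2 / κ =
            κ * ((e + l) * Q / r) ^ 2 - 2 * ((e + l) * Q / r) + 1 / κ := by
          field_simp
          ring
        linarith
      have : (e * Q / r + 2) * (l * Q / r + 2) =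
          e * l * Q ^ 2 * (1 / (r : ℝ) ^ 2) + 2 * ((e + l) * Q / r) + 4 := by
        field_simp
        ring
      rw [this]
      have h3 : κ * ((e + l) * Q / r) ^ 2 = κ * (e + l) ^ 2 * Q ^ 2 * (1 / (r : ℝ) ^ 2) := by
        field_simp
      linarith
    refine (Finset.sum_le_sum hterm).trans ?_
    rw [Finset.sum_add_distrib, ← Finset.mul_sum, Finset.sum_const, nsmul_eq_mul]
    have hc : (((Finset.Icc 2 ⌊(1 + ε) * Q⌋₊).card : ℕ) : ℝ) ≤ 2 * Q := by
      rw [Nat.card_Icc]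
      have h1 : ((⌊(1 + ε) * Q⌋₊ + 1 - 2 : ℕ) : ℝ) ≤ (⌊(1 + ε) * Q⌋₊ : ℝ) := by
        exact_mod_cast (by omega : ⌊(1 + ε) * Q⌋₊ + 1 - 2 ≤ ⌊(1 + ε) * Q⌋₊)
      refine h1.trans ((Nat.floor_le (by positivity)).trans ?_)
      nlinarith
    have hs := sum_Icc_one_div_sq_le ⌊(1 + ε) * Q⌋₊
    have hA : 0 ≤ (e * l + κ * (e + l) ^ 2) * Q ^ 2 := by positivity
    have hB : 0 ≤ 4 + 1 / κ := by positivity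
    have := mul_le_mul_of_nonneg_left hs hA
    have := mul_le_mul_of_nonneg_right hc hB
    linarith
  have hdivℓ : e * Q / ℓ ≤ e * Q / 11 := by gcongr
  have hterm2 : (e * Q / ℓ + 2) * (l * Q + 2) ≤ (e * Q / 11 + 2) * (l * Q + 2) := by gcongr
  have hmain : (β + 8) * Q ≤ e * lam * (3 / 100) * Q ^ 2 := by
    rw [div_le_iff₀ (by positivity)] at hQ3
    nlinarith
  have hell : e * l ≤ e * lam * (31 / 30) := by nlinarith
  have hell2 : e * l * Q ^ 2 ≤ e * lam * (31 / 30) * Q ^ 2 := by gcongr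
  have hl2 : ε * lam * Q ^ 2 / (20 * m) = e * lam * Q ^ 2 / 20 := by rw [he]; field_simp
  rw [hl2]
  rw [hκe] at hsum
  have hb2 : β * Q = 2 * (e + lam) * Q + 2 * (e + l) * Q + 2 * (4 + 1 / κ) * Q := by
    rw [hβ]; ring
  have heQ : 0 < e * Q := by positivity
  have hx1 : (e * Q - 2) * (lam * Q - 2) = e * lam * Q ^ 2 - 2 * (e + lam) * Q + 4 := by ring
  have hx2 : (e * Q / 11 + 2) * (l * Q + 2) =
      e * l * Q ^ 2 / 11 + 2 * (e + l) * Q - 20 / 11 * (e * Q) + 4 := by ring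
  have hx3 : 3 / 4 * ((e * l + e * lam * (6 / 100)) * Q ^ 2) =
      3 / 4 * (e * l * Q ^ 2) + 45 / 1000 * (e * lam * Q ^ 2) := by ring
  have hx4 : 0 ≤ e * lam * Q ^ 2 := by positivity
  rw [hx3] at hsum
  rw [hx2] at hterm2
  rw [hx1]
  generalize e * lam * Q ^ 2 = u₁ at *
  generalize e * l * Q ^ 2 = u₂ at *
  linarith

/-! ### The proportion of well approximated points -/

/-- A lower bound for the measure of `S` in each cell of every grid passes to compact sets. -/
theorem exists_grid_le_volume_inter {B : Set ℝ} (hB : IsCompact B) (hB1 : B ⊆ Set.Icc 0 1) {p : ℝ}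
    (hp : 0 < p) :
    ∃ N : ℕ, 0 < N ∧ ∀ S : Set ℝ, MeasurableSet S →
      (∀ i : ℕ, 2 * p / N ≤ volume.real (S ∩ Set.Ico ((i : ℝ) / N) ((i + 1) / N))) →
        p * volume.real B ≤ volume.real (B ∩ S) := by
  have hBfin : volume B ≠ ⊤ := hB.measure_lt_top.ne
  rcases eq_or_ne (volume.real B) 0 with h0 | h0
  · exact ⟨1, one_pos, fun S _ _ => by rw [h0, mul_zero]; exact measureReal_nonneg⟩
  have hpos : 0 < volume.real B := lt_of_le_of_ne measureReal_nonneg h0.symm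
  obtain ⟨U, hBU, hUo, hUlt⟩ := Set.exists_isOpen_lt_add B hBfin
    (ε := ENNReal.ofReal (p * volume.real B)) (by simp; positivity)
  have hUfin : volume U ≠ ⊤ := hUlt.ne_top
  have hUle : volume.real U ≤ volume.real B + p * volume.real B := by
    have h := ENNReal.toReal_mono (by simp [hBfin]) hUlt.le
    rw [ENNReal.toReal_add hBfin (by simp), ENNReal.toReal_ofReal (by positivity)] at h
    exact h
  obtain ⟨δ, hδ, hth⟩ := hB.exists_thickening_subset_open hUo hBU
  obtain ⟨N, hN⟩ := exists_nat_gt (1 / δ)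
  have hN0 : (0 : ℝ) < N := lt_trans (by positivity) hN
  refine ⟨N, by exact_mod_cast hN0, fun S hS hcell => ?_⟩
  classical
  let c : ℕ → Set ℝ := fun i => Set.Ico ((i : ℝ) / N) ((i + 1) / N)
  let J : Finset ℕ := {i ∈ Finset.range (N + 1) | (c i ∩ B).Nonempty}
  have hcm : ∀ i, MeasurableSet (c i) := fun i => measurableSet_Ico
  have hdisj : Pairwise (Function.onFun Disjoint c) := by
    intro i j hij
    refine Set.disjoint_left.mpr fun x hx hy => hij ?_
    have h1 : ∀ i : ℕ, x ∈ c i → ⌊x * N⌋ = i := by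
      intro i hi
      rw [Int.floor_eq_iff]
      have h2 := (div_le_iff₀ hN0).mp hi.1
      have h3 := (lt_div_iff₀ hN0).mp hi.2
      exact ⟨by exact_mod_cast h2, by exact_mod_cast h3⟩
    have := (h1 i hx).symm.trans (h1 j hy)
    exact_mod_cast this
  have hcvol : ∀ i, volume.real (c i) = 1 / N := by
    intro i
    simp only [c]
    rw [Real.volume_real_Ico_of_le (by gcongr; linarith)]
    ring
  have hcU : ∀ i ∈ J, c i ⊆ U := by
    intro i hi x hx
    obtain ⟨z, hz, hzB⟩ := (Finset.mem_filter.mp hi).2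
    refine hth (Metric.mem_thickening_iff.mpr ⟨z, hzB, ?_⟩)
    have hlen : ((i : ℝ) + 1) / N = i / N + 1 / N := by ring
    have h1 : 1 / (N : ℝ) < δ := by
      rw [div_lt_iff₀ hN0]
      rw [div_lt_iff₀ hδ] at hN
      linarith
    have h2 := hx.1
    have h3 := hx.2
    have h4 := hz.1
    have h5 := hz.2
    rw [Real.dist_eq, abs_lt]
    constructor <;> linarith
  have hVU : (⋃ i ∈ J, c i) ⊆ U := Set.iUnion₂_subset hcU
  have hBV : B ⊆ ⋃ i ∈ J, c i := by
    intro x hx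
    have hx0 := (hB1 hx).1
    have hx1 := (hB1 hx).2
    have hmem : x ∈ c ⌊x * N⌋₊ := by
      refine ⟨?_, ?_⟩
      · rw [div_le_iff₀ hN0]; exact Nat.floor_le (by positivity)
      · rw [lt_div_iff₀ hN0]; exact Nat.lt_floor_add_one _
    refine Set.mem_iUnion₂.mpr ⟨⌊x * N⌋₊, Finset.mem_filter.mpr ⟨?_, x, hmem, hx⟩, hmem⟩
    rw [Finset.mem_range, Nat.lt_succ_iff]
    refine Nat.floor_le_of_le ?_
    nlinarith
  have hVfin : volume (⋃ i ∈ J, c i) ≠ ⊤ := ne_top_of_le_ne_top hUfin (measure_mono hVU)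
  have hSV : 2 * p * (J.card / N) ≤ volume.real (S ∩ ⋃ i ∈ J, c i) := by
    rw [Set.inter_iUnion₂, measureReal_biUnion_finset
      (fun i _ j _ hij => ((hdisj hij).inter_left' S).inter_right' S)
      (fun i _ => hS.inter (hcm i))
      (fun i hi => ne_top_of_le_ne_top hUfin
        (measure_mono (Set.inter_subset_right.trans (hcU i hi))))]
    refine le_trans (le_of_eq ?_) (Finset.card_nsmul_le_sum J _ (2 * p / N) fun i _ => hcell i)
    rw [nsmul_eq_mul]
    ring
  have hVvol : volume.real (⋃ i ∈ J, c i) = J.card / N := by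
    rw [measureReal_biUnion_finset (fun i _ j _ hij => hdisj hij) (fun i _ => hcm i)
      (fun i hi => ne_top_of_le_ne_top hUfin (measure_mono (hcU i hi)))]
    simp only [hcvol, Finset.sum_const, nsmul_eq_mul]
    ring
  have hBle : volume.real B ≤ J.card / N := hVvol ▸ measureReal_mono hBV hVfin
  have hsplit : volume.real (S ∩ ⋃ i ∈ J, c i) ≤ volume.real (B ∩ S) + volume.real (U \ B) := by
    refine (measureReal_mono ?_ ?_).trans (measureReal_union_le _ _)
    · rintro x ⟨hxS, hxV⟩
      by_cases hxB : x ∈ B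
      · exact Or.inl ⟨hxB, hxS⟩
      · exact Or.inr ⟨hVU hxV, hxB⟩
    · exact ne_top_of_le_ne_top hUfin (measure_mono
        (Set.union_subset (Set.inter_subset_left.trans hBU) Set.sdiff_subset))
  have hdiff : volume.real (U \ B) = volume.real U - volume.real B :=
    measureReal_sdiff hBU hB.measurableSet hUfin
  have h1 := mul_le_mul_of_nonneg_left hBle (by positivity : 0 ≤ 2 * p)
  linarith

/-- Distinct fractions with denominators at most `R` are at least `1 / R²` apart. -/
theorem one_div_sq_le_abs_sub {a q a' q' : ℤ} (hq : 0 < q) (hq' : 0 < q') (h : IsCoprime a q)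
    (h' : IsCoprime a' q') (hne : (q, a) ≠ (q', a')) {R : ℝ} (hR : (q : ℝ) ≤ R)
    (hR' : (q' : ℝ) ≤ R) : 1 / R ^ 2 ≤ |(a : ℝ) / q - a' / q'| := by
  have hq0 : (0 : ℝ) < q := by exact_mod_cast hq
  have hq0' : (0 : ℝ) < q' := by exact_mod_cast hq'
  have hint : a * q' - a' * q ≠ 0 := by
    intro h0
    have e : a * q' = a' * q := by linarith
    have d1 : q ∣ q' := h.symm.dvd_of_dvd_mul_left (e ▸ dvd_mul_left q a')
    have d2 : q' ∣ q := h'.symm.dvd_of_dvd_mul_left (e ▸ dvd_mul_left q' a)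
    have hqq : q = q' := Int.dvd_antisymm hq.le hq'.le d1 d2
    subst hqq
    exact hne (by rw [mul_right_cancel₀ hq.ne' e])
  have h1 : (1 : ℝ) ≤ |(a : ℝ) * q' - a' * q| := by
    exact_mod_cast Int.one_le_abs hint
  have e : (a : ℝ) / q - a' / q' = (a * q' - a' * q) / (q * q') := by
    field_simp
  rw [e, abs_div, abs_of_pos (by positivity : (0 : ℝ) < q * q')]
  gcongr
  nlinarith

/-- In a cell, `approxSet` contains the disjoint intervals of radius `y / k` about the fractions
`a / (ℓ q)` with `(q, a)` in `fractionPairs`. The margins of length `L / 4` keep these intervals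
inside the cell, and `8 ≤ k Y` makes them disjoint. -/
theorem le_volume_cell_inter_approxSet {m ℓ k : ℕ} (hm : 0 < m) (hℓ : ℓ.Prime) {Y : ℝ} (hY : 0 < Y)
    (hk : 1 ≤ k) (hkY : 8 ≤ k * Y) {y Q α L : ℝ} (hy : 0 < y) (hQ : 0 < Q)
    (hQy : ((m * ℓ : ℕ) : ℝ) ^ 2 * Q ^ 2 * y * Y = 1) (hyL : y / k ≤ L / 4) :
    (fractionPairs m ℓ (1 / (3 * k)) (ℓ * L / 2) Q (ℓ * (α + L / 4))).card * (2 * (y / k)) ≤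
      volume.real (approxSet m Y k (m * ℓ) y ∩ Set.Ico α (α + L)) := by
  have hk1 : (1 : ℝ) ≤ k := by exact_mod_cast hk
  have hk0 : (0 : ℝ) < k := by linarith
  have hm1 : (1 : ℝ) ≤ m := by exact_mod_cast hm
  have hℓ1 : (1 : ℝ) ≤ ℓ := by exact_mod_cast hℓ.one_lt.le
  have hm0 : (0 : ℝ) < m := by linarith
  have hℓ0 : (0 : ℝ) < ℓ := by linarith
  set T := fractionPairs m ℓ (1 / (3 * k)) (ℓ * L / 2) Q (ℓ * (α + L / 4)) with hT
  have hε3 : 1 / (3 * (k : ℝ)) ≤ 1 / 3 := by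
    rw [div_le_div_iff₀ (by positivity) (by norm_num)]; linarith
  have hprop : ∀ z ∈ T, Q < z.1 ∧ (z.1 : ℝ) ≤ (1 + 1 / (3 * k)) * Q ∧ z.1 ≡ 1 [ZMOD m] ∧
      ℓ * (α + L / 4) * z.1 < z.2 ∧ (z.2 : ℝ) ≤ (ℓ * (α + L / 4) + ℓ * L / 2) * z.1 ∧
        ¬ (ℓ : ℤ) ∣ z.1 ∧ IsCoprime z.2 z.1 := by
    rintro ⟨q, a⟩ hz
    rw [hT, fractionPairs] at hz
    simp only [Finset.mem_filter, Finset.mem_sigma, Finset.mem_Ioc] at hz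
    obtain ⟨⟨⟨⟨h1, h2⟩, h3⟩, h4, h5⟩, h6, h7⟩ := hz
    exact ⟨Int.floor_lt.mp h1, Int.le_floor.mp h2, h3, Int.floor_lt.mp h4, Int.le_floor.mp h5, h6, h7⟩
  have hpos : ∀ z ∈ T, (0 : ℤ) < z.1 := fun z hz => by
    exact_mod_cast hQ.trans (hprop z hz).1
  have hball : ∀ z ∈ T, Metric.ball ((z.2 : ℝ) / (ℓ * z.1)) (y / k) ⊆
      approxSet m Y k (m * ℓ) y ∩ Set.Ico α (α + L) := by
    intro z hz x hx
    obtain ⟨h1, h2, h3, h4, h5, h6, h7⟩ := hprop z hz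
    have hq0 : (0 : ℝ) < z.1 := hQ.trans h1
    rw [Metric.mem_ball, Real.dist_eq] at hx
    have hmq : IsCoprime (m : ℤ) z.1 := by
      obtain ⟨t, ht⟩ := h3.dvd
      exact ⟨t, 1, by linear_combination -ht⟩
    refine ⟨⟨z.2, z.1, hpos z hz, hmq.mul_left h7, ?_, ?_, ?_⟩, ?_⟩
    · push_cast
      exact hmq.mul_left ((Prime.coprime_iff_not_dvd (Nat.prime_iff_prime_int.mp hℓ)).mpr h6)
    · have e : ((m * ℓ : ℕ) : ℝ) ^ 2 * (z.1 : ℝ) ^ 2 * y * Y = ((z.1 : ℝ) / Q) ^ 2 := by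
        calc ((m * ℓ : ℕ) : ℝ) ^ 2 * (z.1 : ℝ) ^ 2 * y * Y
            = ((m * ℓ : ℕ) : ℝ) ^ 2 * Q ^ 2 * y * Y * ((z.1 : ℝ) / Q) ^ 2 := by field_simp
          _ = ((z.1 : ℝ) / Q) ^ 2 := by rw [hQy, one_mul]
      have g1 : 1 < (z.1 : ℝ) / Q := by rwa [one_lt_div hQ]
      have g2 : (z.1 : ℝ) / Q ≤ 1 + 1 / (3 * k) := by rwa [div_le_iff₀ hQ]
      rw [e, abs_lt]
      have g3 : 1 / (k : ℝ) = 3 * (1 / (3 * k)) := by field_simp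
      have g4 : (0 : ℝ) < 1 / (3 * k) := by positivity
      constructor <;> nlinarith
    · convert! hx using 3
      push_cast
      field_simp
    · have c1 : α + L / 4 < (z.2 : ℝ) / (ℓ * z.1) := by
        rw [lt_div_iff₀ (by positivity)]; linarith
      have c2 : (z.2 : ℝ) / (ℓ * z.1) ≤ α + 3 * L / 4 := by
        rw [div_le_iff₀ (by positivity)]; linarith
      have := abs_lt.mp hx
      exact ⟨by linarith [this.1], by linarith [this.2]⟩
  have hdisj : (T : Set (Σ _ : ℤ, ℤ)).PairwiseDisjoint
      fun z => Metric.ball ((z.2 : ℝ) / (ℓ * z.1)) (y / k) := by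
    intro z hz z' hz' hne
    obtain ⟨h1, h2, -, -, -, -, h7⟩ := hprop z hz
    obtain ⟨h1', h2', -, -, -, -, h7'⟩ := hprop z' hz'
    refine Metric.ball_disjoint_ball ?_
    have hR : (1 + 1 / (3 * (k : ℝ))) * Q ≤ 2 * Q := by gcongr; linarith
    have hsep := one_div_sq_le_abs_sub (hpos z hz) (hpos z' hz') h7 h7'
      (fun h => hne (by
        obtain ⟨h8, h9⟩ := Prod.mk.inj h
        exact Sigma.ext h8 (heq_of_eq h9))) (h2.trans hR) (h2'.trans hR)
    have e : (z.2 : ℝ) / (ℓ * z.1) - z'.2 / (ℓ * z'.1) = (z.2 / z.1 - z'.2 / z'.1) / ℓ := by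
      rw [sub_div, div_div, div_div, mul_comm (ℓ : ℝ), mul_comm (ℓ : ℝ)]
    rw [Real.dist_eq, e, abs_div, abs_of_pos hℓ0]
    have hQ2 : 1 / (2 * Q) ^ 2 = ((m * ℓ : ℕ) : ℝ) ^ 2 * y * Y / 4 := by
      rw [div_eq_iff (by positivity)]
      linear_combination -hQy
    rw [hQ2] at hsep
    refine le_trans ?_ (div_le_div_of_nonneg_right hsep hℓ0.le)
    push_cast
    have e2 : ((m : ℝ) * ℓ) ^ 2 * y * Y / 4 / ℓ = (m : ℝ) ^ 2 * ℓ * (k * Y) / 4 * (y / k) := by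
      field_simp
    have e3 : (1 : ℝ) ≤ (m : ℝ) ^ 2 * ℓ := one_le_mul_of_one_le_of_one_le (one_le_pow₀ hm1) hℓ1
    have e4 : 2 ≤ (m : ℝ) ^ 2 * ℓ * (k * Y) / 4 := by nlinarith
    have e5 : 0 ≤ y / k := by positivity
    rw [e2]
    nlinarith
  have hvol : volume.real (⋃ z ∈ T, Metric.ball ((z.2 : ℝ) / (ℓ * z.1)) (y / k)) =
      T.card * (2 * (y / k)) := by
    rw [measureReal_biUnion_finset hdisj (fun _ _ => measurableSet_ball)
      (fun _ _ => measure_ball_lt_top.ne)]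
    simp only [Real.volume_real_ball (by positivity : 0 ≤ y / k), Finset.sum_const, nsmul_eq_mul]
  rw [← hvol]
  refine measureReal_mono (Set.iUnion₂_subset hball) ?_
  exact ne_top_of_le_ne_top (by simp) (measure_mono Set.inter_subset_right)

/-- As `y → 0`, the set `approxSet` occupies at least the proportion `b / (k² n)` of every compact
set. The bound `11 m ≤ k` forces `ℓ ≥ 11` and `ε = 1 / (3 k) ≤ 1 / 30`, as the sieve requires. -/
theorem exists_eventually_le_volume_inter_approxSet {m : ℕ} (hm : 0 < m) {Y : ℝ} (hY : 0 < Y) :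
    ∃ b > 0, ∃ k₀ : ℕ, ∀ k, k₀ ≤ k → ∀ n ∈ primeMultiples m, k ≤ n → ∀ B : Set ℝ, IsCompact B →
      B ⊆ Set.Icc 0 1 → ∀ᶠ y in 𝓝[>] (0 : ℝ),
        b / k ^ 2 / n * volume.real B ≤ volume.real (B ∩ approxSet m Y k n y) := by
  have hm0 : (0 : ℝ) < m := by exact_mod_cast hm
  refine ⟨1 / (120 * m ^ 2 * Y), by positivity, 11 * m + ⌈8 / Y⌉₊, ?_⟩
  rintro k hk n ⟨ℓ, hℓ, -, rfl⟩ hkn B hB hB1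
  have hkm : 11 * m ≤ k := by omega
  have hℓ11 : 11 ≤ ℓ := by
    by_contra! h
    have : m * ℓ < m * 11 := Nat.mul_lt_mul_of_pos_left h hm
    omega
  have hkY : 8 ≤ k * Y := by
    have h1 : (8 / Y : ℝ) ≤ k := (Nat.le_ceil _).trans (by exact_mod_cast (by omega))
    rwa [div_le_iff₀ hY] at h1
  have hk11 : (11 : ℝ) ≤ k := by exact_mod_cast (by omega : 11 ≤ k)
  have hk0 : (0 : ℝ) < k := by linarith
  have hℓ0 : (0 : ℝ) < ℓ := by exact_mod_cast hℓ.pos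
  obtain ⟨N, hN, hgrid⟩ := exists_grid_le_volume_inter hB hB1
    (p := 1 / (120 * m ^ 2 * Y) / k ^ 2 / ((m * ℓ : ℕ) : ℝ)) (by push_cast; positivity)
  have hN0 : (0 : ℝ) < N := by exact_mod_cast hN
  have hcount := eventually_le_card_fractionPairs hm hℓ11 (ε := 1 / (3 * k))
    (lam := ℓ * (1 / N) / 2) (by positivity)
    (by rw [div_le_div_iff₀ (by positivity) (by norm_num)]; linarith) (by positivity)
  -- the size of `q` for which `Γ (a / (n q) + iy)` has the height required by `approxSet`
  have hQlim : Tendsto (fun y : ℝ => (((m * ℓ : ℕ) : ℝ) * √(y * Y))⁻¹) (𝓝[>] 0) atTop := by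
    refine Tendsto.inv_tendsto_nhdsGT_zero (tendsto_nhdsWithin_iff.mpr ⟨?_, ?_⟩)
    · have : ContinuousAt (fun y : ℝ => ((m * ℓ : ℕ) : ℝ) * √(y * Y)) 0 := by fun_prop
      have h := this.tendsto.mono_left (nhdsWithin_le_nhds (s := Set.Ioi 0))
      simpa using h
    · filter_upwards [self_mem_nhdsWithin] with y hy
      have hy' : (0 : ℝ) < y := hy
      push_cast
      have : 0 < √(y * Y) := Real.sqrt_pos.mpr (by positivity)
      exact Set.mem_Ioi.mpr (by positivity)
  filter_upwards [hQlim.eventually hcount, self_mem_nhdsWithin,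
    Ioo_mem_nhdsGT (by positivity : (0 : ℝ) < k * (1 / N / 4))] with y hcy hy hy2
  have hy0 : (0 : ℝ) < y := hy
  refine hgrid _ (isOpen_approxSet _ _ _ _ _).measurableSet fun i => ?_
  set Q := (((m * ℓ : ℕ) : ℝ) * √(y * Y))⁻¹ with hQdef
  have hs : 0 < √(y * Y) := Real.sqrt_pos.mpr (by positivity)
  have hnpos : (0 : ℝ) < ((m * ℓ : ℕ) : ℝ) := by push_cast; positivity
  have hQ0 : 0 < Q := by positivity
  have hQy : ((m * ℓ : ℕ) : ℝ) ^ 2 * Q ^ 2 * y * Y = 1 := by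
    rw [hQdef, inv_pow, mul_pow, Real.sq_sqrt (by positivity)]
    field_simp
  have hyk : y / k ≤ 1 / N / 4 := by
    rw [div_le_iff₀ hk0]; linarith [hy2.2]
  have h := le_volume_cell_inter_approxSet hm hℓ hY (by omega) hkY hy0 hQ0
    hQy hyk (α := i / N)
  rw [show ((i : ℝ) + 1) / N = i / N + 1 / N by ring]
  refine le_trans ?_ h
  refine le_trans (le_of_eq ?_) (mul_le_mul_of_nonneg_right (hcy _) (by positivity))
  have hQ2 : Q ^ 2 = 1 / (((m * ℓ : ℕ) : ℝ) ^ 2 * y * Y) := by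
    rw [eq_div_iff (by positivity)]; linarith
  rw [hQ2]
  push_cast
  field_simp
  norm_num

/-! ### Limiting measures for almost every point -/

/-- A point which lies in `approxSet` at arbitrarily large levels `k` has the limiting measure
`ν_{m,Y}`. -/
theorem ModularSurface.nu_mem_limitMeasures {m : ℕ} (hm : 0 < m) {Y : ℝ} (hY : 0 < Y)
    {y : ℕ → ℝ} (hy : ∀ n ∈ primeMultiples m, 0 < y n) {k₀ : ℕ} {x : ℝ}
    (hx : ∀ k, k₀ ≤ k → ∃ n ∈ primeMultiples m, k ≤ n ∧ x ∈ approxSet m Y k n (y n)) :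
    nu m Y ∈ limitMeasures (primeMultiples m) fun n => delta n (x : UnitAddCircle) (y n) := by
  have hx' : ∀ k, ∃ n ∈ primeMultiples m, k₀ + k ≤ n ∧ x ∈ approxSet m Y (k₀ + k) n (y n) :=
    fun k => hx _ (Nat.le_add_right _ _)
  choose N hN hkN hmem using hx'
  have hNtop : Tendsto N atTop atTop :=
    tendsto_atTop_mono (fun k => (Nat.le_add_left k k₀).trans (hkN k)) tendsto_id
  obtain ⟨φ, hφ, hNφ⟩ := strictMono_subseq_of_tendsto_atTop hNtop
  refine ⟨isFiniteMeasure_nu hm Y, N ∘ φ, hNφ, fun i => hN _, fun Ψ => ?_⟩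
  have hΨ : Continuous Ψ := Ψ.1.continuous
  obtain ⟨M, hM⟩ := Ψ.hasCompactSupport.exists_bound_of_continuous hΨ
  have hlim : Tendsto (fun k => ∫ z, Ψ z ∂(delta (N k) (x : UnitAddCircle) (y (N k)))) atTop
      (𝓝 (∫ z, Ψ z ∂(nu m Y))) := by
    rw [Metric.tendsto_atTop']
    intro ε hε
    have h := eventually_abs_integral_delta_sub_le hΨ hM hm hY (half_pos hε)
    obtain ⟨K, hK⟩ := eventually_atTop.mp h
    refine ⟨K, fun k hk => ?_⟩
    rw [Real.dist_eq]
    refine (hK (k₀ + k) (by omega) (N k) (hN k) (hkN k) x _ (hy _ (hN k)) (hmem k)).trans_lt ?_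
    linarith
  exact hlim.comp hφ.tendsto_atTop

theorem theorem1p7 (m : ℕ) (hm : 0 < m) (Y : ℝ) (hY : 0 < Y) (hmY : 1 < (m : ℝ) ^ 2 * Y)
    (c : ℕ → ℝ) (hc : ∀ n ∈ primeMultiples m, 0 < c n) :
    ∃ y : ℕ → ℝ, (∀ n ∈ primeMultiples m, 0 < y n ∧ y n < c n) ∧
      ∀ᵐ x : UnitAddCircle,
        ModularSurface.nu m Y ∈ ModularSurface.limitMeasures (primeMultiples m)
          (fun n => ModularSurface.delta n x (y n)) := by
  obtain ⟨b, hb, k₀, hvol⟩ := exists_eventually_le_volume_inter_approxSet hm hY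
  obtain ⟨y, hy, hae⟩ := exists_seq_ae_forall_exists_mem (k₀ := k₀ + 1)
    (isOpen_approxSet m Y) (p := fun k n => b / k ^ 2 / n) (fun k n => by positivity)
    (fun k hk => hvol k (by omega))
    (fun k hk => by
      have hk0 : (0 : ℝ) < k := by exact_mod_cast (show 0 < k by omega)
      exact not_summable_indicator_primeMultiples hm k (by positivity)) hc
  refine ⟨y, hy, ?_⟩
  have hIoc : ∀ᵐ t : Set.Ioc (0 : ℝ) (0 + 1) ∂(Measure.comap Subtype.val volume),
      ModularSurface.nu m Y ∈ ModularSurface.limitMeasures (primeMultiples m)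
        fun n => ModularSurface.delta n ((t : ℝ) : UnitAddCircle) (y n) := by
    have h := (ae_restrict_iff_subtype (μ := volume) measurableSet_Ioc).mp
      (ae_restrict_of_ae (s := Set.Ioc (0 : ℝ) (0 + 1)) hae)
    filter_upwards [h] with t ht
    exact ModularSurface.nu_mem_limitMeasures hm hY (fun n hn => (hy n hn).1)
      (ht ⟨t.2.1.le, by simpa using t.2.2⟩)
  filter_upwards [(AddCircle.measurePreserving_equivIoc (1 : ℝ) (a := 0)).quasiMeasurePreserving.ae
    hIoc] with x hx
  have e : (((AddCircle.equivIoc (1 : ℝ) 0 x : Set.Ioc (0 : ℝ) (0 + 1)) : ℝ) : UnitAddCircle) = x :=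
    (AddCircle.equivIoc (1 : ℝ) 0).symm_apply_apply x
  rwa [e] at hx
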